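/- \textbf{Language.} Session types $A,B$ are polarised; for a context $\Xi$ of polarised type variables they are generated by positive types: $\mathbf 1$, $\alpha^+$, $\rho\alpha^+.A$ ($A$ positive), ${\downarrow}A$ ($A$ negative), $\oplus\{l:A_l\}_{l\in L}$, $A\otimes B$, $\tau\wedge A$ ($A,A_l,B$ positive); negative types: $\alpha^-$, $\rho\alpha^-.A$ ($A$ negative), ${\uparrow}A$ ($A$ positive), $\&\{l:A_l\}_{l\in L}$ ($A_l$ negative), $A\multimap B$ ($A$ positive, $B$ negative), $\tau\supset A$ ($A$ negative); the label sets $L$ are finite. Functional types are $\tau\to\sigma$ and the quoted-process types $\{a:A\leftarrow\overline{a_i:A_i}\}$ with $A,A_i$ closed. Terms $\Psi\vdash M:\tau$ are variables, $\lambda x{:}\tau.M$, $MN$, $\mathsf{fix}\,x.M$ and quoted processes $a\leftarrow\{P\}\leftarrow\overline{a_i}$. Process judgments $\Psi;\Delta\vdash P::c:C$ (functional context $\Psi$, unordered linear context $\Delta$ of closed session types) are given by the rules below. To the right of each rule stands the denotation of its conclusion. We write a context and the input (output) on it in the same order; $\llbracket P\rrbracket u(\delta^+,c^-)=(\delta^-,c^+)$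 is the value of the premise $P$ at environment $u$ on the inputs shown; $\mathrm{strict}_x$ sends every input with $x=\bot$ to $\bot$ (the least element of the whole output); $v_{\!\uparrow}$ is the image of $v$ in a lifted domain, and $\mathsf{down}$ maps $v_\uparrow\mapsto v$, $\bot\mapsto\bot$. \textbf{Domains.} A domain is a pointed dcpo; $D_\bot$ is lifting, $[D\to E]$ the continuous and $[D\multimap E]_{s}$ the strict continuous maps, ordered pointwise. Each closed session type $A$ has a negative aspect $A^-$ and a positive aspect $A^+$: $\mathbf1^-=\{\bot\}$, $\mathbf1^+=\{*\}_\bot$; $({\downarrow}A)^-=A^-$, $({\downarrow}A)^+=A^+_\bot$; $({\uparrow}A)^-=A^-_\bot$, $({\uparrow}A)^+=A^+$; $(\oplus\{l:A_l\})^-=\prod_l A_l^-$, $(\oplus\{l:A_l\})^+=\bigoplus_l (A_l^+)_\bot$ (coalesced sum); $(\&\{l:A_l\})^-=\bigoplus_l(A_l^-)_\bot$, $(\&\{l:A_l\})^+=\prod_lA_l^+$; $(A\otimes B)^-=A^-\times B^-$, $(A\otimes B)^+=(A^+\times B^+)_\bot$; $(A\multimap B)^-=(A^+\times B^-)_\bot$,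 $(A\multimap B)^+=A^-\times B^+$; $(\tau\wedge A)^-=A^-$, $(\tau\wedge A)^+=(\llbracket\tau\rrbracket\times A^+)_\bot$; $(\tau\supset A)^-=(\llbracket\tau\rrbracket\times A^-)_\bot$, $(\tau\supset A)^+=A^+$. A type variable denotes a pair (negative aspect, positive aspect), so an open type denotes a pair of locally continuous functors on pairs of domains and strict maps; $((\rho\alpha.A)^-,(\rho\alpha.A)^+)$ is the canonical (bilimit) fixed point of the pair denoted by $A$, with canonical isomorphisms $\mathsf{Fold}:([\rho\alpha.A/\alpha]A)^{q}\cong(\rho\alpha.A)^{q}:\mathsf{Unfold}$, $q\in\{-,+\}$. For a linear context, $\Delta^{q}=\prod_{a:A\in\Delta}A^{q}$. Finally $\llbracket\tau\to\sigma\rrbracket=[\llbracket\tau\rrbracket\multimap\llbracket\sigma\rrbracket]_{s}$, $\llbracket\{a:A\leftarrow\Delta\}\rrbracket=[\Delta^+\times A^-\to\Delta^-\times A^+]_\bot$ and $\llbracket\Psi\rrbracket=\prod_{x:\tau\in\Psi}\llbracket\tau\rrbracket$. \textbf{Terms} denote continuous maps $\llbracket\Psi\rrbracket\to\llbracket\tau\rrbracket$: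 variables are projections; $\llbracket\lambda x.M\rrbracket u=\mathrm{strict}(v\mapsto\llbracket M\rrbracket[u\,|\,x\mapsto v])$; $\llbracket MN\rrbracket u=\llbracket M\rrbracket u(\llbracket N\rrbracket u)$; $\llbracket\mathsf{fix}\,x.M\rrbracket u$ is the least fixed point of $v\mapsto\llbracket M\rrbracket[u\,|\,x\mapsto v]$; $\llbracket a\leftarrow\{P\}\leftarrow\overline{a_i}\rrbracket u=(\llbracket P\rrbracket u)_\uparrow$. \textbf{Processes} $\Psi;\Delta\vdash P::c:C$ denote continuous maps $\llbracket\Psi\rrbracket\to[\Delta^+\times C^-\to\Delta^-\times C^+]$, invariantly under reordering of $\Delta$: (forward) $\Psi;a:A\vdash a\to b::b:A$:\quad $(a^+,b^-)\mapsto(b^-,a^+)$. (cut) $\Psi;\Delta_1,\Delta_2\vdash a:P;Q::c:C$ from $\Psi;\Delta_1\vdash P::a:A$ and $\Psi;a:A,\Delta_2\vdash Q::c:C$:\quad the trace of $\llbracket P\rrbracket u\times\llbracket Q\rrbracket u$ over $A^-\times A^+$, i.e. $(\delta_1^+,\delta_2^+,c^-)\mapsto(\delta_1^-,\delta_2^-,c^+)$,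 where $(a^-,a^+)$ is the least pair such that $\llbracket P\rrbracket u(\delta_1^+,a^-)=(\delta_1^-,a^+)$ and $\llbracket Q\rrbracket u(a^+,\delta_2^+,c^-)=(a^-,\delta_2^-,c^+)$ for some $\delta_1^-,\delta_2^-,c^+$. ($\mathbf1$) $\Psi;\cdot\vdash\mathsf{close}\,a::a:\mathbf1$: $a^+=*$; and $\Psi;\Delta,a:\mathbf1\vdash\mathsf{wait}\,a;P::c:C$ from $\Psi;\Delta\vdash P::c:C$: $\mathrm{strict}_{a^+}((\delta^+,a^+,c^-)\mapsto(\delta^-,\bot,c^+))$. (shifts) for ${\downarrow}A$: sending shift from $\Psi;\Delta\vdash P::a:A$ to $\Psi;\Delta\vdash\mathsf{send}\,a\,\mathsf{shift};P::a:{\downarrow}A$ post-composes with lifting on $a^+$; receiving shift from $\Psi;\Delta,a:A\vdash P::c:C$ to $\Psi;\Delta,a:{\downarrow}A\vdash\mathsf{shift}\leftarrow\mathsf{recv}\,a;P::c:C$ pre-composes with $\mathsf{down}$ on $a^+$ and is made $\mathrm{strict}_{a^+}$; for ${\uparrow}A$: dually, receiving when $a$ is provided ($\mathsf{down}$ on $a^-$,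 $\mathrm{strict}_{a^-}$) and sending when $a$ is used (lifting on $a^-$). (choices) $\Psi;\Delta\vdash a.k;P::a:\oplus\{l:A_l\}$ from $\Psi;\Delta\vdash P::a:A_k$: $(\delta^+,(a_l^-)_l)\mapsto(\delta^-,(k,(a_k^+)_\uparrow))$; $\Psi;\Delta,a:\oplus\{l:A_l\}\vdash\mathsf{case}\,a\{l\Rightarrow P_l\}::c:C$ from $\Psi;\Delta,a:A_l\vdash P_l::c:C$ for all $l\in L$: $\mathrm{strict}_{a^+}((\delta^+,(k,(a_k^+)_\uparrow),c^-)\mapsto(\delta^-,(k:a_k^-,\,l\ne k:\bot),c^+))$ computed with $P_k$; dually for $\&$ (case when $a$ is provided, selection when $a$ is used). (channels) $\Psi;\Delta,b:B\vdash\mathsf{send}\,a\,b;P::a:B\otimes A$ from $\Psi;\Delta\vdash P::a:A$: $(\delta^+,b^+,(a_B^-,a_A^-))\mapsto(\delta^-,a_B^-,(b^+,a_A^+)_\uparrow)$; $\Psi;\Delta,a:B\otimes A\vdash b\leftarrow\mathsf{recv}\,a;P::c:C$ from $\Psi;\Delta,a:A,b:B\vdash P::c:C$: $\mathrm{strict}_{a^+}((\delta^+,(a_B^+,a_A^+)_\uparrow,c^-)\mapsto(\delta^-,(b^-,a^-),c^+))$;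 dually, $\Psi;\Delta\vdash b\leftarrow\mathsf{recv}\,a;P::a:B\multimap A$ from $\Psi;\Delta,b:B\vdash P::a:A$: $\mathrm{strict}_{a^-}((\delta^+,(a_B^+,a_A^-)_\uparrow)\mapsto(\delta^-,(b^-,a^+)))$; $\Psi;\Delta,b:B,a:B\multimap A\vdash\mathsf{send}\,a\,b;P::c:C$ from $\Psi;\Delta,a:A\vdash P::c:C$: $(\delta^+,b^+,(a_B^-,a_A^+),c^-)\mapsto(\delta^-,a_B^-,(b^+,a_A^-)_\uparrow,c^+)$. (values) $\Psi;\Delta\vdash\mathsf{send}\,a\,M;P::a:\tau\wedge A$ from $\Psi\vdash M:\tau$ and $\Psi;\Delta\vdash P::a:A$: $(\delta^+,a^-)\mapsto\bot$ if $\llbracket M\rrbracket u=\bot$, and $(\delta^+,a^-)\mapsto(\delta^-,(v,a^+)_\uparrow)$ if $\llbracket M\rrbracket u=v\ne\bot$; $\Psi;\Delta,a:\tau\wedge A\vdash x\leftarrow\mathsf{recv}\,a;P::c:C$ from $\Psi,x:\tau;\Delta,a:A\vdash P::c:C$: $\mathrm{strict}_{a^+}((\delta^+,(v,\alpha^+)_\uparrow,c^-)\mapsto\llbracket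 P\rrbracket[u\,|\,x\mapsto v](\delta^+,\alpha^+,c^-))$; dually for $\tau\supset A$ (receive when $a$ is provided, send when $a$ is used). (recursion) $\Psi;\Delta\vdash{-}::a:\rho\alpha.A$ from $\Psi;\Delta\vdash P::a:[\rho\alpha.A/\alpha]A$: $\mathsf{Unfold}$ before on $a^-$, $\mathsf{Fold}$ after on $a^+$; $\Psi;\Delta,a:\rho\alpha.A\vdash{-}::c:C$ from $\Psi;\Delta,a:[\rho\alpha.A/\alpha]A\vdash P::c:C$: $\mathsf{Unfold}$ before on $a^+$, $\mathsf{Fold}$ after on $a^-$ (sending or receiving $\mathsf{unfold}$ according to polarity). (unquote) $\Psi;\Delta\vdash a\leftarrow\{M\}\leftarrow\overline{a_i}::a:A$ from $\Psi\vdash M:\{a:A\leftarrow\Delta\}$: $\mathsf{down}(\llbracket M\rrbracket u)$. Two processes with the same typing are equivalent, $P\equiv P'$, if their denotations are equal. $[M/x]Q$ is capture-avoiding substitution. \textbf{Proposition.} Let $A$ be a closed positive session type, $C$ a closed session type of either polarity and $\tau$ a functional type. For all $\Psi;\Delta_1\vdash P::a:A$, all $\Psi,x:\tau;a:A,\Delta_2\vdash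 Q::c:C$ and all $\Psi\vdash M:\tau$ such that $\llbracket M\rrbracket u\neq\bot$ for every $u\in\llbracket\Psi\rrbracket$, $$ a:P;\,[M/x]Q\;\;\equiv\;\;a:(\mathsf{send}\,a\,M;P);\,(x\leftarrow\mathsf{recv}\,a;Q). $$ -/

import Mathlib

open CategoryTheory

namespace SILL

/-! ### Pointed dcpos and Scott-continuous maps -/

section Order

/-- A pointed partial order with suprema of nonempty directed sets is a pointed dcpo. -/
@[reducible] noncomputable def cpoOfLub (α : Type) [PartialOrder α] [OrderBot α]
    (h : ∀ d : Set α, d.Nonempty → DirectedOn (· ≤ ·) d → ∃ a, IsLUB d a) :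
    CompletePartialOrder α :=
  have h' : ∀ d : Set α, DirectedOn (· ≤ ·) d → ∃ a, IsLUB d a := fun d hd => by
    rcases d.eq_empty_or_nonempty with rfl | hne
    · exact ⟨⊥, isLUB_empty⟩
    · exact h d hne hd
  { (inferInstance : PartialOrder α), (inferInstance : OrderBot α) with
    sSup := fun d => Classical.epsilon fun a => IsLUB d a
    lubOfDirected := fun d hd => Classical.epsilon_spec (h' d hd) }

theorem exists_lub {α : Type} [CompletePartialOrder α] {d : Set α}
    (hd : DirectedOn (· ≤ ·) d) : ∃ a, IsLUB d a :=
  ⟨sSup d, CompletePartialOrder.lubOfDirected d hd⟩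

theorem directedOn_image {α β : Type} [Preorder α] [Preorder β] {d : Set α} {f : α → β}
    (hf : Monotone f) (hd : DirectedOn (· ≤ ·) d) : DirectedOn (· ≤ ·) (f '' d) := by
  rintro _ ⟨x, hx, rfl⟩ _ ⟨y, hy, rfl⟩
  obtain ⟨z, hz, hxz, hyz⟩ := hd x hx y hy
  exact ⟨f z, ⟨z, hz, rfl⟩, hf hxz, hf hyz⟩

noncomputable instance punitCPO : CompletePartialOrder PUnit.{1} :=
  cpoOfLub _ fun _ _ _ => ⟨PUnit.unit, by constructor <;> intro _ _ <;> exact le_rfl⟩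

noncomputable instance prodCPO {α β : Type} [CompletePartialOrder α] [CompletePartialOrder β] :
    CompletePartialOrder (α × β) :=
  cpoOfLub _ fun _ _ hd => by
    obtain ⟨a, ha⟩ := exists_lub (directedOn_image monotone_fst hd)
    obtain ⟨b, hb⟩ := exists_lub (directedOn_image monotone_snd hd)
    exact ⟨(a, b), isLUB_prod.2 ⟨ha, hb⟩⟩

noncomputable instance piCPO {ι : Type} {α : ι → Type} [∀ i, CompletePartialOrder (α i)] :
    CompletePartialOrder (∀ i, α i) :=
  cpoOfLub _ fun d _ hd => by
    choose a ha using fun i => exists_lub (directedOn_image (Function.monotone_eval i) hd)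
    exact ⟨a, isLUB_pi.2 ha⟩

theorem withBot_isLUB {α : Type} [PartialOrder α] {d : Set (WithBot α)} {x : α}
    (hd : ∃ y : α, (y : WithBot α) ∈ d) (hx : IsLUB {y : α | (y : WithBot α) ∈ d} x) :
    IsLUB d (x : WithBot α) := by
  obtain ⟨y, hy⟩ := hd
  refine ⟨fun w hw => ?_, fun w hw => ?_⟩
  · induction w with
    | bot => exact bot_le
    | coe w => exact WithBot.coe_le_coe.2 (hx.1 hw)
  · induction w with
    | bot => exact absurd (hw hy) (by simp)
    | coe w => exact WithBot.coe_le_coe.2 (hx.2 fun z hz => WithBot.coe_le_coe.1 (hw hz))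

theorem isLUB_withBot {α : Type} [PartialOrder α] {d : Set (WithBot α)} {x : α}
    (hx : IsLUB d (x : WithBot α)) :
    (∃ y : α, (y : WithBot α) ∈ d) ∧ IsLUB {y : α | (y : WithBot α) ∈ d} x := by
  constructor
  · by_contra! h
    have : (x : WithBot α) ≤ ⊥ := hx.2 fun w hw => by
      induction w with
      | bot => exact le_rfl
      | coe w => exact absurd hw (h w)
    simp at this
  · refine ⟨fun y hy => WithBot.coe_le_coe.1 (hx.1 hy), fun y hy => WithBot.coe_le_coe.1 (hx.2 ?_)⟩
    intro w hw
    induction w with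
    | bot => exact bot_le
    | coe w => exact WithBot.coe_le_coe.2 (hy hw)

theorem directedOn_withBot {α : Type} [PartialOrder α] {d : Set (WithBot α)}
    (hd : DirectedOn (· ≤ ·) d) : DirectedOn (· ≤ ·) {y : α | (y : WithBot α) ∈ d} := by
  intro x hx y hy
  obtain ⟨z, hz, hxz, hyz⟩ := hd _ hx _ hy
  induction z with
  | bot => simp at hxz
  | coe z => exact ⟨z, hz, WithBot.coe_le_coe.1 hxz, WithBot.coe_le_coe.1 hyz⟩

/-- Lifting: adjoining a new bottom element. -/
@[reducible] noncomputable def withBotCPO (α : Type) [PartialOrder α]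
    (h : ∀ d : Set α, d.Nonempty → DirectedOn (· ≤ ·) d → ∃ a, IsLUB d a) :
    CompletePartialOrder (WithBot α) :=
  cpoOfLub _ fun d _ hd => by
    by_cases hne : ∃ y : α, (y : WithBot α) ∈ d
    · obtain ⟨a, ha⟩ := h _ hne (directedOn_withBot hd)
      exact ⟨a, withBot_isLUB hne ha⟩
    · push Not at hne
      refine ⟨⊥, fun w hw => ?_, fun w _ => bot_le⟩
      induction w with
      | bot => exact le_rfl
      | coe w => exact absurd hw (hne w)

noncomputable instance liftCPO {α : Type} [CompletePartialOrder α] : CompletePartialOrder (WithBot α) :=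
  withBotCPO α fun _ _ hd => exists_lub hd

theorem sigma_directedOn {ι : Type} {α : ι → Type} [∀ i, PartialOrder (α i)]
    {d : Set (Σ i, α i)} (hne : d.Nonempty) (hd : DirectedOn (· ≤ ·) d) :
    ∃ i, ∃ e : Set (α i), d = Sigma.mk i '' e ∧ e.Nonempty ∧ DirectedOn (· ≤ ·) e := by
  obtain ⟨⟨i, x⟩, hx⟩ := hne
  refine ⟨i, {y | (⟨i, y⟩ : Σ i, α i) ∈ d}, ?_, ⟨x, hx⟩, ?_⟩
  · ext ⟨j, y⟩
    constructor
    · intro hy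
      obtain ⟨⟨k, z⟩, hz, h1, h2⟩ := hd _ hx _ hy
      cases h1
      cases h2
      exact ⟨y, hy, rfl⟩
    · rintro ⟨y', hy', h⟩
      cases h
      exact hy'
  · intro y hy z hz
    obtain ⟨⟨k, w⟩, hw, h1, h2⟩ := hd _ hy _ hz
    cases h1 with
    | fiber _ _ w h1 =>
      cases h2 with
      | fiber _ _ _ h2 => exact ⟨w, hw, h1, h2⟩

theorem sigma_isLUB {ι : Type} {α : ι → Type} [∀ i, PartialOrder (α i)] {i : ι}
    {e : Set (α i)} (hne : e.Nonempty) {a : α i} :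
    IsLUB (Sigma.mk i '' e) (⟨i, a⟩ : Σ i, α i) ↔ IsLUB e a := by
  obtain ⟨x, hx⟩ := hne
  constructor
  · intro h
    refine ⟨fun y hy => Sigma.mk_le_mk_iff.1 (h.1 ⟨y, hy, rfl⟩), fun y hy =>
      Sigma.mk_le_mk_iff.1 (h.2 ?_)⟩
    rintro _ ⟨z, hz, rfl⟩
    exact Sigma.mk_le_mk_iff.2 (hy hz)
  · intro h
    refine ⟨?_, ?_⟩
    · rintro _ ⟨z, hz, rfl⟩
      exact Sigma.mk_le_mk_iff.2 (h.1 hz)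
    · rintro ⟨j, b⟩ hb
      have h1 := hb ⟨x, hx, rfl⟩
      cases h1
      exact Sigma.mk_le_mk_iff.2 (h.2 fun z hz => Sigma.mk_le_mk_iff.1 (hb ⟨z, hz, rfl⟩))

/-- The lifted disjoint union of domains `A l`, which is the coalesced sum of the lifted domains
`(A l)_⊥`: its elements are `⊥` and the tagged elements `(k, a)` with `a : A k`. -/
noncomputable instance liftSigmaCPO {ι : Type} {α : ι → Type} [∀ i, CompletePartialOrder (α i)] :
    CompletePartialOrder (WithBot (Σ i, α i)) :=
  withBotCPO _ fun d hne hd => by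
    obtain ⟨i, e, rfl, hne, he⟩ := sigma_directedOn hne hd
    obtain ⟨a, ha⟩ := exists_lub he
    exact ⟨⟨i, a⟩, (sigma_isLUB hne).2 ha⟩

end Order

section Scott

variable {α β γ δ : Type}

theorem scott_of_pointwise [Preorder α] [Preorder β] {S : Set (α → β)} {g : α → β}
    (hS : ∀ f ∈ S, ScottContinuous f) (hg : ∀ x, IsLUB ((fun f => f x) '' S) (g x)) :
    ScottContinuous g := by
  intro d hne hd a ha
  refine ⟨?_, fun b hb => (hg a).2 ?_⟩
  · rintro _ ⟨x, hx, rfl⟩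
    refine (hg x).2 ?_
    rintro _ ⟨f, hf, rfl⟩
    exact ((hS f hf).monotone (ha.1 hx)).trans ((hg a).1 ⟨f, hf, rfl⟩)
  · rintro _ ⟨f, hf, rfl⟩
    refine (hS f hf hne hd ha).2 ?_
    rintro _ ⟨x, hx, rfl⟩
    exact ((hg x).1 ⟨f, hf, rfl⟩).trans (hb ⟨x, hx, rfl⟩)

theorem scott_comp [Preorder α] [Preorder β] [Preorder γ] {g : β → γ} {f : α → β}
    (hg : ScottContinuous g) (hf : ScottContinuous f) : ScottContinuous fun a => g (f a) :=
  hf.comp hg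

theorem scott_pi {ι : Type} {π : ι → Type} [Preorder α] [∀ i, Preorder (π i)] {f : α → ∀ i, π i}
    (h : ∀ i, ScottContinuous fun a => f a i) : ScottContinuous f := by
  intro d hne hd a ha
  refine isLUB_pi.2 fun i => ?_
  rw [Set.image_image]
  exact h i hne hd ha

theorem scott_apply {ι : Type} {π : ι → Type} [∀ i, Preorder (π i)] (i : ι) :
    ScottContinuous fun f : (∀ i, π i) => f i :=
  fun _ _ _ _ ha => isLUB_pi.1 ha i

theorem scott_apply_comp {ι : Type} {π : ι → Type} [Preorder α] [∀ i, Preorder (π i)] (i : ι)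
    {f : α → ∀ i, π i} (h : ScottContinuous f) : ScottContinuous fun a => f a i :=
  scott_comp (scott_apply i) h

@[fun_prop]
theorem scott_coe [PartialOrder α] [PartialOrder β] {f : α → β} (hf : ScottContinuous f) :
    ScottContinuous fun a => (f a : WithBot β) := by
  intro d hne hd a ha
  have h := hf hne hd ha
  refine withBot_isLUB ⟨_, Set.mem_image_of_mem _ hne.some_mem⟩ ?_
  convert h using 1
  ext y
  simp

theorem scott_sigmaMk {ι : Type} {π : ι → Type} [∀ i, PartialOrder (π i)] (i : ι) :
    ScottContinuous (fun x => (⟨i, x⟩ : Σ i, π i)) :=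
  fun _ hne _ _ ha => (sigma_isLUB hne).2 ha

/-- The strict extension of `f` to the lifted domain. -/
def lifted [PartialOrder β] [OrderBot β] (f : α → β) : WithBot α → β := WithBot.recBotCoe ⊥ f

@[simp] theorem lifted_bot [PartialOrder β] [OrderBot β] (f : α → β) : lifted f ⊥ = ⊥ := rfl

@[simp] theorem lifted_coe [PartialOrder β] [OrderBot β] (f : α → β) (a : α) :
    lifted f (a : WithBot α) = f a := rfl

@[fun_prop]
theorem scott_lifted [PartialOrder α] [PartialOrder β] [OrderBot β] [PartialOrder γ]
    {f : γ → α → β} (hf : ScottContinuous fun p : γ × α => f p.1 p.2)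
    {g : γ → WithBot α} (hg : ScottContinuous g) :
    ScottContinuous fun c => lifted (f c) (g c) := by
  have key : ScottContinuous fun p : γ × WithBot α => lifted (f p.1) p.2 := by
    refine ScottContinuous.fromProd (fun c => ?_) (fun w => ?_)
    · have hfc : ScottContinuous (f c) :=
        scott_comp (g := fun p : γ × α => f p.1 p.2) hf
          (ScottContinuous.prodMk (ScottContinuous.const c) ScottContinuous.id)
      intro d hne hd a ha
      induction a with
      | bot =>
        have : d = {⊥} := by
          refine (Set.Nonempty.subset_singleton_iff hne).1 fun w hw => ?_
          exact le_bot_iff.1 (ha.1 hw)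
        subst this
        simp
      | coe a =>
        obtain ⟨hne', ha'⟩ := isLUB_withBot ha
        have h := hfc hne' (directedOn_withBot hd) ha'
        refine ⟨?_, fun b hb => h.2 ?_⟩
        · rintro _ ⟨w, hw, rfl⟩
          induction w with
          | bot => exact bot_le
          | coe w => exact h.1 ⟨w, hw, rfl⟩
        · rintro _ ⟨y, hy, rfl⟩
          exact hb ⟨_, hy, rfl⟩
    · induction w with
      | bot => exact ScottContinuous.const _
      | coe w =>
        exact scott_comp hf (ScottContinuous.prodMk ScottContinuous.id (ScottContinuous.const w))
  exact scott_comp key (ScottContinuous.prodMk ScottContinuous.id hg)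

theorem scott_sigmaElim {ι : Type} {π : ι → Type} [∀ i, PartialOrder (π i)] [PartialOrder β]
    [PartialOrder γ] {f : γ → (i : ι) → π i → β}
    (hf : ∀ i, ScottContinuous fun p : γ × π i => f p.1 i p.2) :
    ScottContinuous fun p : γ × (Σ i, π i) => f p.1 p.2.1 p.2.2 := by
  refine ScottContinuous.fromProd (fun c => ?_) (fun w => ?_)
  · intro d hne hd a ha
    obtain ⟨i, e, rfl, hne', he⟩ := sigma_directedOn hne hd
    obtain ⟨j, a⟩ := a
    obtain ⟨x, hx⟩ := hne'
    have h1 := ha.1 ⟨x, hx, rfl⟩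
    cases h1
    rw [Set.image_image]
    exact scott_comp (hf i) (ScottContinuous.prodMk (ScottContinuous.const c) ScottContinuous.id)
      ⟨x, hx⟩ he ((sigma_isLUB ⟨x, hx⟩).1 ha)
  · exact scott_comp (hf w.1) (ScottContinuous.prodMk ScottContinuous.id (ScottContinuous.const w.2))

open Classical in
/-- `strictIn a f` is `f` made strict in the component `a`. -/
noncomputable def strictIn [PartialOrder α] [OrderBot α] [PartialOrder β] [OrderBot β]
    (a : α) (b : β) : β := if a = ⊥ then ⊥ else b

@[fun_prop]
theorem scott_strictIn [PartialOrder α] [OrderBot α] [PartialOrder β] [OrderBot β]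
    [PartialOrder γ] {f : γ → α} {g : γ → β} (hf : ScottContinuous f) (hg : ScottContinuous g) :
    ScottContinuous fun c => strictIn (f c) (g c) := by
  unfold strictIn
  intro d hne hd c hc
  have hfc := hf hne hd hc
  have hgc := hg hne hd hc
  by_cases h : f c = ⊥
  · have hz : ∀ x ∈ d, f x = ⊥ := fun x hx => le_bot_iff.1 (h ▸ hfc.1 ⟨x, hx, rfl⟩)
    refine ⟨?_, fun b _ => by simp [h]⟩
    rintro _ ⟨x, hx, rfl⟩
    simp [h, hz x hx]
  · obtain ⟨x₀, hx₀, hne₀⟩ : ∃ x ∈ d, f x ≠ ⊥ := by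
      by_contra! hall
      refine h (le_bot_iff.1 (hfc.2 ?_))
      rintro _ ⟨x, hx, rfl⟩
      exact (hall x hx).le
    refine ⟨?_, fun b hb => ?_⟩
    · rintro _ ⟨x, hx, rfl⟩
      by_cases hx' : f x = ⊥
      · simp [hx']
      · simpa [h, hx'] using hgc.1 ⟨x, hx, rfl⟩
    · simp only [h, if_false]
      refine hgc.2 ?_
      rintro _ ⟨x, hx, rfl⟩
      obtain ⟨z, hz, hxz, h0z⟩ := hd x hx x₀ hx₀
      have hfz : f z ≠ ⊥ := fun e => hne₀ (le_bot_iff.1 (e ▸ hf.monotone h0z))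
      have := hb ⟨z, hz, rfl⟩
      simp only [hfz, if_false] at this
      exact (hg.monotone hxz).trans this

/-- Scott-continuous maps between pointed dcpos. -/
structure ScottMap (α β : Type) [CompletePartialOrder α] [CompletePartialOrder β] where
  toFun : α → β
  cont : ScottContinuous toFun

end Scott

infixr:25 " →ˢ " => ScottMap

namespace ScottMap

variable {α β γ δ : Type} [CompletePartialOrder α] [CompletePartialOrder β]
  [CompletePartialOrder γ] [CompletePartialOrder δ]

instance instFunLike : FunLike (α →ˢ β) α β where
  coe := toFun
  coe_injective f g h := by cases f; cases g; congr

@[simp] theorem mk_apply (f : α → β) (h : ScottContinuous f) (a : α) :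
    (ScottMap.mk f h : α →ˢ β) a = f a := rfl

@[ext] theorem ext {f g : α →ˢ β} (h : ∀ x, f x = g x) : f = g := DFunLike.ext _ _ h

theorem scott (f : α →ˢ β) : ScottContinuous f := f.cont

instance instPartialOrder : PartialOrder (α →ˢ β) := PartialOrder.lift (fun f x => f x) DFunLike.coe_injective

theorem le_def {f g : α →ˢ β} : f ≤ g ↔ ∀ x, f x ≤ g x := Iff.rfl

instance instOrderBot : OrderBot (α →ˢ β) where
  bot := ⟨fun _ => ⊥, ScottContinuous.const ⊥⟩
  bot_le _ _ := bot_le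

@[simp] theorem bot_apply (x : α) : (⊥ : α →ˢ β) x = ⊥ := rfl

theorem exists_pointwise_lub {S : Set (α →ˢ β)} (hS : DirectedOn (· ≤ ·) S) :
    ∃ g : α →ˢ β, ∀ x, IsLUB ((fun f => f x) '' S) (g x) := by
  choose g hg using fun x => exists_lub
    (directedOn_image (f := fun f : α →ˢ β => f x) (fun _ _ h => h x) hS)
  refine ⟨⟨g, scott_of_pointwise (S := (fun f : α →ˢ β => (f : α → β)) '' S) ?_ fun x => ?_⟩, hg⟩
  · rintro _ ⟨f, _, rfl⟩
    exact f.scott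
  · rw [Set.image_image]
    exact hg x

theorem isLUB_of_pointwise {S : Set (α →ˢ β)} {g : α →ˢ β}
    (hg : ∀ x, IsLUB ((fun f => f x) '' S) (g x)) : IsLUB S g :=
  ⟨fun f hf x => (hg x).1 ⟨f, hf, rfl⟩, fun h hh x => (hg x).2 (by
    rintro _ ⟨f, hf, rfl⟩; exact hh hf x)⟩

noncomputable instance instCPO : CompletePartialOrder (α →ˢ β) :=
  cpoOfLub _ fun _ _ hS => (exists_pointwise_lub hS).imp fun _ hg => isLUB_of_pointwise hg

theorem isLUB_apply {S : Set (α →ˢ β)} (hS : DirectedOn (· ≤ ·) S) {g : α →ˢ β} (hg : IsLUB S g)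
    (x : α) : IsLUB ((fun f => f x) '' S) (g x) := by
  obtain ⟨g', hg'⟩ := exists_pointwise_lub hS
  rw [hg.unique (isLUB_of_pointwise hg')]
  exact hg' x

theorem scott_into {ε : Type} [PartialOrder ε] {f : ε → α →ˢ β} (h : ∀ x, ScottContinuous fun c => f c x) :
    ScottContinuous f := by
  intro d hne hd a ha
  refine isLUB_of_pointwise fun x => ?_
  rw [Set.image_image]
  exact h x hne hd ha

theorem scott_eval : ScottContinuous fun p : (α →ˢ β) × α => p.1 p.2 :=
  ScottContinuous.fromProd (fun f => f.scott) fun x _ _ hd _ ha => isLUB_apply hd ha x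

end ScottMap

@[fun_prop]
theorem scott_app {α β γ : Type} [CompletePartialOrder α] [CompletePartialOrder β] [PartialOrder γ]
    {f : γ → α →ˢ β} {g : γ → α} (hf : ScottContinuous f) (hg : ScottContinuous g) :
    ScottContinuous fun c => f c (g c) :=
  scott_comp ScottMap.scott_eval (hf.prodMk hg)

namespace ScottMap

variable {α β γ δ : Type} [CompletePartialOrder α] [CompletePartialOrder β]
  [CompletePartialOrder γ] [CompletePartialOrder δ]

/-- The map `a ↦ (b ↦ f a b)` for a jointly continuous `f`. -/
def lam₂ (f : α → β → γ) (h : ScottContinuous fun p : α × β => f p.1 p.2) : α →ˢ β →ˢ γ :=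
  ⟨fun a => ⟨f a, scott_comp (g := fun p : α × β => f p.1 p.2) h ((ScottContinuous.const a).prodMk ScottContinuous.id)⟩,
    scott_into fun b => scott_comp h (ScottContinuous.id.prodMk (ScottContinuous.const b))⟩

@[simp] theorem lam₂_apply (f : α → β → γ) (h) (a : α) (b : β) : lam₂ f h a b = f a b := rfl

theorem isLUB_iterate (f : α →ˢ α) : IsLUB (Set.range fun n => f^[n] ⊥) (⨆ n, f^[n] ⊥) := by
  refine CompletePartialOrder.lubOfDirected _ (directedOn_range.2 (Monotone.directed_le ?_))
  exact Monotone.monotone_iterate_of_le_map f.scott.monotone bot_le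

/-- The continuous least-fixed-point operator. -/
noncomputable def lfp : (α →ˢ α) →ˢ α where
  toFun f := ⨆ n, f^[n] ⊥
  cont := by
    refine scott_of_pointwise (S := Set.range fun (n : ℕ) (f : α →ˢ α) => f^[n] ⊥) ?_ fun f => ?_
    · rintro _ ⟨n, rfl⟩
      induction n with
      | zero => exact ScottContinuous.const _
      | succ n ih =>
        simp only [Function.iterate_succ_apply']
        fun_prop
    · rw [← Set.range_comp]
      exact isLUB_iterate f

/-- The parametrised fixed-point operator, `dagger f a = lfp (fun x => f (a, x))`. -/
noncomputable def dagger : (α × β →ˢ β) →ˢ (α →ˢ β) :=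
  lam₂ (fun f a => lfp (lam₂ (fun (p : (α × β →ˢ β) × α) x => p.1 (p.2, x)) (by fun_prop) (f, a)))
    (by have := (lfp (α := β)).scott; fun_prop)

/-- The trace operator, `trace f = π_B ∘ f ∘ ⟨id, dagger (π_X ∘ f)⟩`. -/
noncomputable def trace : (α × γ →ˢ β × γ) →ˢ (α →ˢ β) :=
  lam₂ (fun f a => (f (a, dagger ⟨fun p => (f p).2, by have := f.scott; fun_prop⟩ a)).1) (by
    have h : ScottContinuous fun f : (α × γ →ˢ β × γ) =>
        (⟨fun p => (f p).2, by have := f.scott; fun_prop⟩ : α × γ →ˢ γ) :=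
      scott_into fun x => by simp only [mk_apply]; fun_prop
    exact scott_comp ScottContinuous.fst (scott_app ScottContinuous.fst
      (ScottContinuous.snd.prodMk (scott_app (scott_comp dagger.scott
        (scott_comp h ScottContinuous.fst)) ScottContinuous.snd))))

end ScottMap

/-! ### The category of domains and strict maps, and locally continuous functors -/

/-- Strict Scott-continuous maps. -/
structure StrictMap (α β : Type) [CompletePartialOrder α] [CompletePartialOrder β] where
  toScott : α →ˢ β
  strict : toScott ⊥ = ⊥

infixr:25 " →! " => StrictMap

namespace StrictMap

variable {α β γ : Type} [CompletePartialOrder α] [CompletePartialOrder β] [CompletePartialOrder γ]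

instance instFunLike : FunLike (α →! β) α β where
  coe f := f.toScott
  coe_injective f g h := by
    cases f; cases g; congr; exact DFunLike.coe_injective h

@[simp] theorem mk_apply (f : α →ˢ β) (h : f ⊥ = ⊥) (a : α) :
    (StrictMap.mk f h : α →! β) a = f a := rfl

@[ext] theorem ext {f g : α →! β} (h : ∀ x, f x = g x) : f = g := DFunLike.ext _ _ h

theorem scott (f : α →! β) : ScottContinuous f := f.toScott.cont

@[simp] theorem map_bot (f : α →! β) : f ⊥ = ⊥ := f.strict

instance instPartialOrder : PartialOrder (α →! β) := PartialOrder.lift (fun f x => f x) DFunLike.coe_injective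

theorem le_def {f g : α →! β} : f ≤ g ↔ ∀ x, f x ≤ g x := Iff.rfl

instance instOrderBot : OrderBot (α →! β) where
  bot := ⟨⊥, rfl⟩
  bot_le _ _ := bot_le

@[simp] theorem bot_apply (x : α) : (⊥ : α →! β) x = ⊥ := rfl

theorem isLUB_of_pointwise {S : Set (α →! β)} {g : α →! β}
    (hg : ∀ x, IsLUB ((fun f => f x) '' S) (g x)) : IsLUB S g :=
  ⟨fun f hf x => (hg x).1 ⟨f, hf, rfl⟩, fun h hh x => (hg x).2 (by
    rintro _ ⟨f, hf, rfl⟩; exact hh hf x)⟩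

theorem exists_pointwise_lub {S : Set (α →! β)} (hS : DirectedOn (· ≤ ·) S) :
    ∃ g : α →! β, ∀ x, IsLUB ((fun f => f x) '' S) (g x) := by
  obtain ⟨g, hg⟩ := ScottMap.exists_pointwise_lub
    (directedOn_image (f := toScott) (fun _ _ h => h) hS)
  simp only [Set.image_image] at hg
  refine ⟨⟨g, le_bot_iff.1 ((hg ⊥).2 ?_)⟩, hg⟩
  rintro _ ⟨f, _, rfl⟩
  exact (f.strict).le

noncomputable instance instCPO : CompletePartialOrder (α →! β) :=
  cpoOfLub _ fun _ _ hS => (exists_pointwise_lub hS).imp fun _ hg => isLUB_of_pointwise hg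

theorem isLUB_apply {S : Set (α →! β)} (hS : DirectedOn (· ≤ ·) S) {g : α →! β} (hg : IsLUB S g)
    (x : α) : IsLUB ((fun f => f x) '' S) (g x) := by
  obtain ⟨g', hg'⟩ := exists_pointwise_lub hS
  rw [hg.unique (isLUB_of_pointwise hg')]
  exact hg' x

theorem scott_into {ε : Type} [PartialOrder ε] {f : ε → α →! β}
    (h : ∀ x, ScottContinuous fun c => f c x) : ScottContinuous f := by
  intro d hne hd a ha
  refine isLUB_of_pointwise fun x => ?_
  rw [Set.image_image]
  exact h x hne hd ha

theorem scott_eval : ScottContinuous fun p : (α →! β) × α => p.1 p.2 :=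
  ScottContinuous.fromProd (fun f => f.scott) fun x _ _ hd _ ha => isLUB_apply hd ha x

/-- Identity. -/
def id : α →! α := ⟨⟨fun x => x, ScottContinuous.id⟩, rfl⟩

/-- Composition. -/
def comp (g : β →! γ) (f : α →! β) : α →! γ :=
  ⟨⟨fun x => g (f x), scott_comp g.scott f.scott⟩, by
    change g (f ⊥) = ⊥; simp⟩

end StrictMap

@[fun_prop]
theorem scott_strict_app {α β γ : Type} [CompletePartialOrder α] [CompletePartialOrder β]
    [PartialOrder γ] {f : γ → α →! β} {g : γ → α} (hf : ScottContinuous f)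
    (hg : ScottContinuous g) : ScottContinuous fun c => f c (g c) :=
  scott_comp StrictMap.scott_eval (hf.prodMk hg)

/-- A semantic domain: a bundled pointed dcpo. -/
structure Dom : Type 1 where
  carrier : Type
  [cpo : CompletePartialOrder carrier]

instance Dom.coeSort : CoeSort Dom Type := ⟨Dom.carrier⟩

attribute [instance] Dom.cpo

/-- The category of domains and strict Scott-continuous maps. -/
instance Dom.category : Category.{0} Dom where
  Hom D E := D →! E
  id _ := StrictMap.id
  comp f g := StrictMap.comp g f

instance Dom.homFunLike (D E : Dom) : FunLike (D ⟶ E) D E := inferInstanceAs (FunLike (D →! E) D E)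

namespace Dom

/-- A strict continuous map as a morphism of domains. -/
abbrev hom {D E : Dom} (f : D →! E) : D ⟶ E := f

@[ext] theorem hom_ext {D E : Dom} {f g : D ⟶ E} (h : ∀ x, f x = g x) : f = g := StrictMap.ext h

@[simp] theorem id_apply {D : Dom} (x : D) : (𝟙 D : D ⟶ D) x = x := rfl

@[simp] theorem comp_apply {D E F : Dom} (f : D ⟶ E) (g : E ⟶ F) (x : D) :
    (f ≫ g) x = g (f x) := rfl

theorem hom_scott {D E : Dom} (f : D ⟶ E) : ScottContinuous f := StrictMap.scott f

@[simp] theorem hom_bot {D E : Dom} (f : D ⟶ E) : f ⊥ = ⊥ := StrictMap.map_bot f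

end Dom

/-- Categories enriched over pointed dcpos. -/
class OCategory (C : Type 1) [Category.{0} C] where
  homCPO (X Y : C) : CompletePartialOrder (X ⟶ Y)
  comp_cont (X Y Z : C) : ScottContinuous fun p : (X ⟶ Y) × (Y ⟶ Z) => p.1 ≫ p.2

attribute [reducible, instance] OCategory.homCPO

noncomputable instance Dom.homCPO (D E : Dom) : CompletePartialOrder (D ⟶ E) :=
  inferInstanceAs (CompletePartialOrder (D →! E))

theorem scott_hom_into {D E : Dom} {ε : Type} [PartialOrder ε] {f : ε → (D ⟶ E)}
    (h : ∀ x, ScottContinuous fun c => f c x) : ScottContinuous f := StrictMap.scott_into h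

theorem scott_hom_app {D E : Dom} {ε : Type} [PartialOrder ε] {f : ε → (D ⟶ E)} {g : ε → D}
    (hf : ScottContinuous f) (hg : ScottContinuous g) : ScottContinuous fun c => f c (g c) :=
  scott_strict_app (f := f) hf hg

noncomputable instance Dom.ocategory : OCategory Dom where
  homCPO X Y := inferInstance
  comp_cont X Y Z := scott_hom_into fun x => by
    exact scott_hom_app (f := fun p : (X ⟶ Y) × (Y ⟶ Z) => p.2) (g := fun p => p.1 x) .snd
      (scott_hom_app (f := fun p : (X ⟶ Y) × (Y ⟶ Z) => p.1) .fst (.const x))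

noncomputable instance piHomCPO {ι : Type} {C : Type 1} [Category.{0} C] [OCategory C] (X Y : ι → C) :
    CompletePartialOrder (X ⟶ Y) :=
  inferInstanceAs (CompletePartialOrder (∀ i, X i ⟶ Y i))

noncomputable instance prodHomCPO {C D : Type 1} [Category.{0} C] [Category.{0} D] [OCategory C] [OCategory D]
    (X Y : C × D) : CompletePartialOrder (X ⟶ Y) :=
  inferInstanceAs (CompletePartialOrder ((X.1 ⟶ Y.1) × (X.2 ⟶ Y.2)))

noncomputable instance piOCategory {ι : Type} {C : Type 1} [Category.{0} C] [OCategory C] :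
    OCategory (ι → C) where
  homCPO X Y := inferInstance
  comp_cont X Y Z := scott_pi fun i => by
    exact scott_comp (f := fun p : (X ⟶ Y) × (Y ⟶ Z) => (p.1 i, p.2 i))
      (OCategory.comp_cont (X i) (Y i) (Z i)) ((scott_comp (scott_apply i) .fst).prodMk (scott_comp (scott_apply i) .snd))

noncomputable instance prodOCategory {C D : Type 1} [Category.{0} C] [Category.{0} D] [OCategory C]
    [OCategory D] : OCategory (C × D) where
  homCPO X Y := inferInstance
  comp_cont X Y Z := by
    exact ScottContinuous.prodMk
      (scott_comp (OCategory.comp_cont X.1 Y.1 Z.1)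
        ((scott_comp .fst .fst).prodMk (scott_comp .fst .snd)))
      (scott_comp (OCategory.comp_cont X.2 Y.2 Z.2)
        ((scott_comp .snd .fst).prodMk (scott_comp .snd .snd)))

/-- Locally continuous functors. -/
structure LCFunctor (C D : Type 1) [Category.{0} C] [Category.{0} D] [OCategory C] [OCategory D]
    extends C ⥤ D where
  map_cont : ∀ X Y : C, ScottContinuous fun f : X ⟶ Y => map f

namespace LCFunctor

variable {B C D E : Type 1} [Category.{0} B] [Category.{0} C] [Category.{0} D]
  [Category.{0} E] [OCategory B] [OCategory C] [OCategory D] [OCategory E]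

/-- Composition of locally continuous functors. -/
def comp (F : LCFunctor C D) (G : LCFunctor D E) : LCFunctor C E where
  toFunctor := F.toFunctor ⋙ G.toFunctor
  map_cont X Y := scott_comp (f := fun f : X ⟶ Y => F.map f) (g := fun f => G.map f)
    (G.map_cont _ _) (F.map_cont X Y)

/-- The identity functor. -/
def ident : LCFunctor C C where
  toFunctor := 𝟭 C
  map_cont _ _ := ScottContinuous.id

/-- Projections. -/
def fst : LCFunctor (C × D) C where
  obj X := X.1
  map f := f.1
  map_cont _ _ := ScottContinuous.fst

/-- Projections. -/
def snd : LCFunctor (C × D) D where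
  obj X := X.2
  map f := f.2
  map_cont _ _ := ScottContinuous.snd

/-- Projections. -/
def eval {ι : Type} (i : ι) : LCFunctor (ι → C) C where
  obj X := X i
  map f := f i
  map_cont _ _ := scott_apply i

/-- Pairing. -/
def pair (F : LCFunctor C D) (G : LCFunctor C E) : LCFunctor C (D × E) where
  obj X := (F.obj X, G.obj X)
  map f := (F.map f, G.map f)
  map_cont X Y := (F.map_cont X Y).prodMk (G.map_cont X Y)

/-- Tupling. -/
def tuple {ι : Type} (F : ι → LCFunctor C D) : LCFunctor C (ι → D) where
  obj X i := (F i).obj X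
  map f i := (F i).map f
  map_id X := by funext i; exact (F i).map_id X
  map_comp f g := by funext i; exact (F i).map_comp f g
  map_cont X Y := scott_pi fun i => (F i).map_cont X Y

/-- Constant functors. -/
def const (X : D) : LCFunctor C D where
  obj _ := X
  map _ := 𝟙 X
  map_cont _ _ := ScottContinuous.const _

/-- The functor `F(-, X)`. -/
def sec (F : LCFunctor (B × C) D) (X : C) : LCFunctor B D where
  obj Y := F.obj (Y, X)
  map f := F.map (f, 𝟙 X)
  map_id Y := F.map_id (Y, X)
  map_comp f g := by rw [← F.map_comp]; congr 1; ext <;> simp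
  map_cont Y Z := scott_comp (F.map_cont (Y, X) (Z, X))
    (ScottContinuous.id.prodMk (ScottContinuous.const _))

/-- The one-point domain. -/
noncomputable abbrev _root_.SILL.Dom.one : Dom := ⟨PUnit⟩

/-- Products `F × G`. -/
noncomputable def prod (F G : LCFunctor C Dom) : LCFunctor C Dom where
  obj X := ⟨F.obj X × G.obj X⟩
  map f := Dom.hom ⟨⟨fun p => (F.map f p.1, G.map f p.2),
      (scott_comp (Dom.hom_scott _) .fst).prodMk (scott_comp (Dom.hom_scott _) .snd)⟩,
      Prod.ext (Dom.hom_bot _) (Dom.hom_bot _)⟩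
  map_id X := by apply StrictMap.ext; intro p; simp only [F.map_id, G.map_id]; rfl
  map_comp f g := by apply StrictMap.ext; intro p; simp only [F.map_comp, G.map_comp]; rfl
  map_cont X Y := scott_hom_into fun p => ScottContinuous.prodMk
    (scott_hom_app (F.map_cont X Y) (.const p.1)) (scott_hom_app (G.map_cont X Y) (.const p.2))

theorem lift_aux {D E : Dom} {ε : Type} [PartialOrder ε] {f : ε → (D ⟶ E)}
    (hf : ScottContinuous f) :
    ScottContinuous fun p : ε × WithBot D => lifted (fun x => (f p.1 x : WithBot E)) p.2 :=
  scott_lifted (f := fun (p : ε × WithBot D) x => (f p.1 x : WithBot E))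
    (scott_coe (scott_hom_app (f := fun p : (ε × WithBot D) × D => f p.1.1)
      (scott_comp hf (scott_comp .fst .fst)) .snd)) .snd

/-- Lifting `F_⊥`. -/
noncomputable def lift (F : LCFunctor C Dom) : LCFunctor C Dom where
  obj X := ⟨WithBot (F.obj X)⟩
  map {X Y} f := Dom.hom ⟨⟨lifted fun x => (F.map f x : WithBot (F.obj Y)),
      scott_comp (f := fun w => (PUnit.unit, w))
        (lift_aux (f := fun _ : PUnit => F.map f) (.const _)) ((ScottContinuous.const _).prodMk .id)⟩,
      rfl⟩
  map_id X := by apply StrictMap.ext; intro p; simp only [F.map_id]; cases p <;> rfl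
  map_comp f g := by apply StrictMap.ext; intro p; simp only [F.map_comp]; cases p <;> rfl
  map_cont X Y := scott_hom_into fun w => scott_comp (f := fun f : X ⟶ Y => (f, w))
    (lift_aux (f := fun f : X ⟶ Y => F.map f) (F.map_cont X Y))
    (ScottContinuous.id.prodMk (.const _))

/-- Products `∏ l, F l`. -/
noncomputable def pi {ι : Type} (F : ι → LCFunctor C Dom) : LCFunctor C Dom where
  obj X := ⟨∀ i, (F i).obj X⟩
  map f := Dom.hom ⟨⟨fun p i => (F i).map f (p i),
      scott_pi fun i => scott_comp (Dom.hom_scott _) (scott_apply i)⟩,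
      funext fun _ => Dom.hom_bot _⟩
  map_id X := by apply StrictMap.ext; intro p; simp only [(F _).map_id]; rfl
  map_comp f g := by apply StrictMap.ext; intro p; simp only [(F _).map_comp]; rfl
  map_cont X Y := scott_hom_into fun p => scott_pi fun i =>
    scott_hom_app ((F i).map_cont X Y) (.const (p i))

theorem sum_aux {ι : Type} {D E : ι → Dom} {ε : Type} [PartialOrder ε]
    {f : ε → ∀ i, (D i ⟶ E i)} (hf : ∀ i, ScottContinuous fun c => f c i) :
    ScottContinuous fun p : ε × WithBot (Σ i, D i) =>
      lifted (fun x => ((⟨x.1, f p.1 x.1 x.2⟩ : Σ i, E i) : WithBot (Σ i, E i))) p.2 :=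
  scott_lifted (f := fun (p : ε × WithBot (Σ i, D i)) x =>
      ((⟨x.1, f p.1 x.1 x.2⟩ : Σ i, E i) : WithBot (Σ i, E i)))
    (scott_sigmaElim (f := fun (p : ε × WithBot (Σ i, D i)) i x =>
        ((⟨i, f p.1 i x⟩ : Σ i, E i) : WithBot (Σ i, E i))) fun i => by
      refine scott_comp (g := fun x => ((⟨i, x⟩ : Σ i, E i) : WithBot (Σ i, E i)))
        (scott_coe (scott_sigmaMk (π := fun i => (E i : Type)) i)) ?_
      exact scott_hom_app (f := fun p : (ε × WithBot (Σ i, D i)) × D i => f p.1.1 i)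
        (scott_comp (hf i) (scott_comp .fst .fst)) .snd) .snd

/-- Coalesced sums of lifted domains `⨁ l, (F l)_⊥`, as lifted disjoint unions. -/
noncomputable def sum {ι : Type} (F : ι → LCFunctor C Dom) : LCFunctor C Dom where
  obj X := ⟨WithBot (Σ i, (F i).obj X)⟩
  map {X Y} f := Dom.hom ⟨⟨lifted fun x =>
        ((⟨x.1, (F x.1).map f x.2⟩ : Σ i, (F i).obj Y) : WithBot (Σ i, (F i).obj Y)),
      scott_comp (f := fun w => (PUnit.unit, w))
        (sum_aux (f := fun (_ : PUnit) i => (F i).map f) fun _ => .const _)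
        ((ScottContinuous.const _).prodMk .id)⟩, rfl⟩
  map_id X := by apply StrictMap.ext; intro p; simp only [(F _).map_id]; cases p <;> rfl
  map_comp f g := by apply StrictMap.ext; intro p; simp only [(F _).map_comp]; cases p <;> rfl
  map_cont X Y := scott_hom_into fun w => scott_comp (f := fun f : X ⟶ Y => (f, w))
    (sum_aux (f := fun (f : X ⟶ Y) i => (F i).map f) fun i => (F i).map_cont X Y)
    (ScottContinuous.id.prodMk (.const _))

end LCFunctor

/-! ### Canonical fixed points of locally continuous functors -/

section Limit

variable {D E : ℕ → Dom}

/-- Compatible sequences along a chain of strict maps. -/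
abbrev Compat (D : ℕ → Dom) (p : ∀ n, D (n + 1) ⟶ D n) : Type :=
  {x : ∀ n, D n // ∀ n, p n (x (n + 1)) = x n}

theorem compat_isLUB {p : ∀ n, D (n + 1) ⟶ D n} {d : Set (Compat D p)} (hne : d.Nonempty)
    (hd : DirectedOn (· ≤ ·) d) :
    ∃ a : Compat D p, ∀ n, IsLUB ((fun x : Compat D p => x.1 n) '' d) (a.1 n) := by
  have hd' := fun n => directedOn_image (f := fun x : Compat D p => x.1 n)
    (fun x y (h : x.1 ≤ y.1) => h n) hd
  choose a ha using fun n => exists_lub (hd' n)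
  refine ⟨⟨a, fun n => ?_⟩, ha⟩
  refine IsLUB.unique (s := p n '' ((fun x : Compat D p => x.1 (n + 1)) '' d)) ?_ ?_
  · exact Dom.hom_scott (p n) (hne.image _) (hd' _) (ha _)
  · rw [Set.image_image]
    simpa only [Subtype.prop] using (show IsLUB ((fun x : Compat D p => p n (x.1 (n + 1))) '' d) _ by
      rw [Set.image_congr fun x _ => x.2 n]; exact ha n)

theorem compat_isLUB_of {p : ∀ n, D (n + 1) ⟶ D n} {d : Set (Compat D p)} {a : Compat D p}
    (ha : ∀ n, IsLUB ((fun x : Compat D p => x.1 n) '' d) (a.1 n)) : IsLUB d a :=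
  ⟨fun x hx n => (ha n).1 ⟨x, hx, rfl⟩, fun b hb n => (ha n).2 (by
    rintro _ ⟨x, hx, rfl⟩; exact hb hx n)⟩

instance compatOrderBot {p : ∀ n, D (n + 1) ⟶ D n} : OrderBot (Compat D p) where
  bot := ⟨fun _ => ⊥, fun _ => Dom.hom_bot _⟩
  bot_le _ := fun _ => bot_le

noncomputable instance compatCPO {p : ∀ n, D (n + 1) ⟶ D n} : CompletePartialOrder (Compat D p) :=
  cpoOfLub _ fun _ hne hd => (compat_isLUB hne hd).imp fun _ h => compat_isLUB_of h

theorem scott_compat_proj {p : ∀ n, D (n + 1) ⟶ D n} (n : ℕ) :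
    ScottContinuous fun x : Compat D p => x.1 n := by
  intro d hne hd a ha
  obtain ⟨a', ha'⟩ := compat_isLUB hne hd
  rw [ha.unique (compat_isLUB_of ha')]
  exact ha' n

theorem scott_compat {α : Type} [PartialOrder α] {p : ∀ n, D (n + 1) ⟶ D n} {f : α → Compat D p}
    (hf : ∀ n, ScottContinuous fun a => (f a).1 n) : ScottContinuous f := by
  intro d hne hd a ha
  refine compat_isLUB_of fun n => ?_
  rw [Set.image_image]
  exact hf n hne hd ha

/-- The limit of a chain of strict maps. -/
noncomputable abbrev Dom.lim (D : ℕ → Dom) (p : ∀ n, D (n + 1) ⟶ D n) : Dom := ⟨Compat D p⟩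

/-- The projections of the limit. -/
noncomputable def Dom.limProj (D : ℕ → Dom) (p : ∀ n, D (n + 1) ⟶ D n) (n : ℕ) :
    Dom.lim D p ⟶ D n :=
  Dom.hom ⟨⟨fun x : Compat D p => x.1 n, scott_compat_proj n⟩, rfl⟩

/-- The map into the limit induced by a cone. -/
noncomputable def Dom.limLift {X : Dom} (p : ∀ n, D (n + 1) ⟶ D n) (f : ∀ n, X ⟶ D n)
    (h : ∀ n, f (n + 1) ≫ p n = f n) : X ⟶ Dom.lim D p :=
  Dom.hom ⟨⟨fun x => (⟨fun n => f n x, fun n => by rw [← Dom.comp_apply, h n]⟩ : Compat D p),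
    scott_compat fun n => Dom.hom_scott (f n)⟩, Subtype.ext (funext fun n => Dom.hom_bot (f n))⟩

end Limit

section Fix

variable {ι : Type}

/-- The iterates of an object map, starting from the one-point domains. -/
noncomputable def chain (obj : (ι → Dom) → ι → Dom) : ℕ → ι → Dom
  | 0 => fun _ => Dom.one
  | n + 1 => obj (chain obj n)

/-- The projections `chain obj (n + 1) ⟶ chain obj n`. -/
noncomputable def chainProj (obj : (ι → Dom) → ι → Dom)
    (map : ∀ {X Y : ι → Dom}, (X ⟶ Y) → (obj X ⟶ obj Y)) :
    ∀ n, chain obj (n + 1) ⟶ chain obj n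
  | 0 => (⊥ : chain obj 1 ⟶ chain obj 0)
  | n + 1 => map (chainProj obj map n)

/-- The limit of the chain `1 ← G 1 ← G (G 1) ← ⋯`. -/
noncomputable def chainLim (obj : (ι → Dom) → ι → Dom)
    (map : ∀ {X Y : ι → Dom}, (X ⟶ Y) → (obj X ⟶ obj Y)) (i : ι) : Dom :=
  Dom.lim (fun n => chain obj n i) fun n => chainProj obj map n i

/-- The canonical fixed point of a locally continuous functor (the bilimit of its iterates). -/
noncomputable def FIX (G : LCFunctor (ι → Dom) (ι → Dom)) : ι → Dom :=
  chainLim G.obj G.map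

variable {C : Type 1} [Category.{0} C] [OCategory C]

/-- The action on the iterates of a map of object maps. -/
noncomputable def chainMap {obj obj' : (ι → Dom) → ι → Dom}
    (t : ∀ {D E : ι → Dom}, (D ⟶ E) → (obj D ⟶ obj' E)) : ∀ n, chain obj n ⟶ chain obj' n
  | 0 => 𝟙 (fun _ => Dom.one)
  | n + 1 => t (chainMap t n)

/-- The functor `X ↦ chainLim (obj X)`, for a two-variable functor with action `T` on morphisms
and action `map₁ X` on morphisms in the recursion variable. -/
noncomputable def fixAux (obj : C → (ι → Dom) → ι → Dom)
    (map₁ : ∀ X {D E : ι → Dom}, (D ⟶ E) → (obj X D ⟶ obj X E))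
    (T : ∀ {X Y : C} {D E : ι → Dom}, (X ⟶ Y) → (D ⟶ E) → (obj X D ⟶ obj Y E))
    (hmap : ∀ X {D E : ι → Dom} (g : D ⟶ E), map₁ X g = T (𝟙 X) g)
    (hid : ∀ X D, T (𝟙 X) (𝟙 D) = 𝟙 (obj X D))
    (hcomp : ∀ {X Y Z : C} {D E F : ι → Dom} (f : X ⟶ Y) (g : Y ⟶ Z) (h : D ⟶ E) (k : E ⟶ F),
      T (f ≫ g) (h ≫ k) = T f h ≫ T g k)
    (hcont : ∀ (X Y : C) (D E : ι → Dom),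
      ScottContinuous fun p : (X ⟶ Y) × (D ⟶ E) => T p.1 p.2)
    (i : ι) : LCFunctor C Dom :=
  have comm : ∀ {X Y : C} (f : X ⟶ Y) (n : ℕ),
      chainMap (T f) (n + 1) ≫ chainProj (obj Y) (map₁ Y) n =
        chainProj (obj X) (map₁ X) n ≫ chainMap (T f) n := by
    intro X Y f n
    have key : ∀ {D D' E E' : ι → Dom} (a : D' ⟶ E') (a' : D ⟶ E) (p : D' ⟶ D) (q : E' ⟶ E),
        a ≫ q = p ≫ a' → T f a ≫ map₁ Y q = map₁ X p ≫ T f a' := by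
      intro D D' E E' a a' p q h
      rw [hmap, hmap, ← hcomp, ← hcomp, h, Category.comp_id, Category.id_comp]
    induction n with
    | zero => rfl
    | succ n ih => exact key _ _ _ _ ih
  have mid : ∀ (X : C) (n : ℕ), chainMap (T (𝟙 X)) n = 𝟙 _ := by
    intro X n
    induction n with
    | zero => rfl
    | succ n ih => exact (congrArg (T (𝟙 X)) ih).trans (hid X _)
  have mcomp : ∀ {X Y Z : C} (f : X ⟶ Y) (g : Y ⟶ Z) (n : ℕ),
      chainMap (T (f ≫ g)) n = chainMap (T f) n ≫ chainMap (T g) n := by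
    intro X Y Z f g n
    induction n with
    | zero => rfl
    | succ n ih => exact (congrArg (T (f ≫ g)) ih).trans (hcomp f g _ _)
  have mcont : ∀ (X Y : C) (n : ℕ), ScottContinuous fun f : X ⟶ Y => chainMap (T f) n := by
    intro X Y n
    induction n with
    | zero => exact .const _
    | succ n ih => exact scott_comp (hcont X Y _ _) (ScottContinuous.id.prodMk ih)
  { obj := fun X => chainLim (obj X) (map₁ X) i
    map := fun {X Y} f => Dom.limLift _ (fun n => Dom.limProj _ _ n ≫ chainMap (T f) n i) fun n => by
      ext x
      have h := congrFun (comm f n) i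
      have h' := DFunLike.congr_fun h (x.1 (n + 1))
      refine h'.trans ?_
      change chainMap (T f) n i (chainProj (obj X) (map₁ X) n i (x.1 (n + 1))) = _
      rw [x.2 n]
      rfl
    map_id := fun X => by
      refine Dom.hom_ext fun x => ?_
      refine Subtype.ext (funext fun n => ?_)
      exact DFunLike.congr_fun (congrFun (mid X n) i) (x.1 n)
    map_comp := fun f g => by
      refine Dom.hom_ext fun x => ?_
      refine Subtype.ext (funext fun n => ?_)
      exact DFunLike.congr_fun (congrFun (mcomp f g n) i) (x.1 n)
    map_cont := fun X Y => scott_hom_into fun x => scott_compat fun n =>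
      scott_hom_app (f := fun f : X ⟶ Y => chainMap (T f) n i)
        (scott_comp (scott_apply i) (mcont X Y n)) (.const _) }

/-- The parametrised fixed point `X ↦ FIX (F (-, X))` as a locally continuous functor. -/
noncomputable def LCFunctor.fix (F : ι → LCFunctor ((ι → Dom) × C) Dom) (i : ι) :
    LCFunctor C Dom :=
  fixAux (fun X => ((LCFunctor.tuple F).sec X).obj) (fun X => ((LCFunctor.tuple F).sec X).map)
    (fun {X Y D E} f g => (LCFunctor.tuple F).map (X := (D, X)) (Y := (E, Y)) (g, f))
    (fun _ _ _ _ => rfl) (fun X D => (LCFunctor.tuple F).map_id (D, X))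
    (fun f g h k => (LCFunctor.tuple F).map_comp (X := (_, _)) (Y := (_, _)) (Z := (_, _))
      (h, f) (k, g))
    (fun X Y D E => scott_comp (f := fun p : (X ⟶ Y) × (D ⟶ E) =>
        ((p.2, p.1) : ((D, X) : (ι → Dom) × C) ⟶ (E, Y)))
      ((LCFunctor.tuple F).map_cont (D, X) (E, Y)) (ScottContinuous.snd.prodMk .fst)) i

theorem LCFunctor.fix_obj (F : ι → LCFunctor ((ι → Dom) × C) Dom) (i : ι) (X : C) :
    (LCFunctor.fix F i).obj X = FIX ((LCFunctor.tuple F).sec X) i := rfl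

variable (G : LCFunctor (ι → Dom) (ι → Dom))

/-- The projections of the canonical fixed point onto the iterates. -/
noncomputable def fixProj (n : ℕ) : FIX G ⟶ chain G.obj n := fun _ => Dom.limProj _ _ n

/-- The canonical map `G (FIX G) ⟶ FIX G`. -/
noncomputable def fold : G.obj (FIX G) ⟶ FIX G := fun i =>
  Dom.limLift _ (fun n => match n with
    | 0 => (⊥ : G.obj (FIX G) ⟶ chain G.obj 0) i
    | n + 1 => G.map (fixProj G n) i) fun n => match n with
    | 0 => rfl
    | n + 1 => by
      have h : fixProj G (n + 1) ≫ chainProj G.obj G.map n = fixProj G n := by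
        funext j; ext x; exact x.2 n
      exact congrFun ((G.map_comp (fixProj G (n + 1)) (chainProj G.obj G.map n)).symm.trans
        (congrArg G.map h)) i

/-- The embeddings of the iterates into the canonical fixed point. -/
noncomputable def fixEmb : ∀ n, chain G.obj n ⟶ FIX G
  | 0 => ⊥
  | n + 1 => G.map (fixEmb n) ≫ fold G

/-- The canonical map `FIX G ⟶ G (FIX G)`. -/
noncomputable def unfold : FIX G ⟶ G.obj (FIX G) :=
  ⨆ n, fixProj G (n + 1) ≫ (G.map (fixEmb G n) : chain G.obj (n + 1) ⟶ G.obj (FIX G))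

theorem fixProj_succ (n : ℕ) : fixProj G (n + 1) ≫ chainProj G.obj G.map n = fixProj G n := by
  funext j; ext x; exact x.2 n

theorem fold_proj (n : ℕ) : fold G ≫ fixProj G (n + 1) = G.map (fixProj G n) := rfl

theorem comp_mono {X Y Z : ι → Dom} {f f' : X ⟶ Y} {g g' : Y ⟶ Z} (hf : f ≤ f') (hg : g ≤ g') :
    f ≫ g ≤ f' ≫ g' :=
  (OCategory.comp_cont X Y Z).monotone (show (f, g) ≤ (f', g') from ⟨hf, hg⟩)

theorem emb_proj (n : ℕ) : fixEmb G n ≫ fixProj G n = 𝟙 _ := by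
  induction n with
  | zero => rfl
  | succ n ih =>
    exact (G.map_comp (fixEmb G n) (fixProj G n)).symm.trans ((congrArg G.map ih).trans (G.map_id _))

theorem proj_emb_le (n : ℕ) : chainProj G.obj G.map n ≫ fixEmb G n ≤ fixEmb G (n + 1) := by
  induction n with
  | zero => intro i x; exact bot_le
  | succ n ih =>
    change G.map (chainProj G.obj G.map n) ≫ (G.map (fixEmb G n) ≫ fold G) ≤
      G.map (fixEmb G (n + 1)) ≫ fold G
    rw [← Category.assoc, ← G.map_comp]
    exact comp_mono ((G.map_cont _ _).monotone ih) le_rfl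

theorem unfold_mono : Monotone fun n =>
    fixProj G (n + 1) ≫ (G.map (fixEmb G n) : chain G.obj (n + 1) ⟶ G.obj (FIX G)) := by
  refine monotone_nat_of_le_succ fun n => ?_
  have key : ∀ {A D E Z : ι → Dom} (a : A ⟶ G.obj D) (b : A ⟶ G.obj E) (p : D ⟶ E) (e : E ⟶ Z)
      (e' : D ⟶ Z), a ≫ G.map p = b → p ≫ e ≤ e' → b ≫ G.map e ≤ a ≫ G.map e' := by
    intro A D E Z a b p e e' h1 h2
    rw [← h1, Category.assoc, ← G.map_comp]
    exact comp_mono le_rfl ((G.map_cont _ _).monotone h2)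
  exact key _ _ _ _ _ (fixProj_succ G (n + 1)) (proj_emb_le G n)

theorem projEmb_mono : Monotone fun n => fixProj G n ≫ fixEmb G n := by
  refine monotone_nat_of_le_succ fun n => ?_
  rw [← fixProj_succ G n, Category.assoc]
  exact comp_mono le_rfl (proj_emb_le G n)

theorem isLUB_iSup_of_monotone {α : Type} [CompletePartialOrder α] {f : ℕ → α} (hf : Monotone f) :
    IsLUB (Set.range f) (⨆ n, f n) :=
  CompletePartialOrder.lubOfDirected _ (directedOn_range.2 (Monotone.directed_le hf))

theorem isLUB_map_range {α β : Type} [PartialOrder α] [PartialOrder β] {f : ℕ → α} {g : α → β}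
    {a : α} (hf : Monotone f) (hg : ScottContinuous g) (ha : IsLUB (Set.range f) a) :
    IsLUB (Set.range fun n => g (f n)) (g a) := by
  have := hg (Set.range_nonempty f) (directedOn_range.2 (Monotone.directed_le hf)) ha
  rwa [← Set.range_comp] at this

theorem isLUB_projEmb : IsLUB (Set.range fun n => fixProj G n ≫ fixEmb G n) (𝟙 (FIX G)) := by
  have hk : ∀ k, (fixProj G k ≫ fixEmb G k) ≫ fixProj G k = fixProj G k := fun k => by
    rw [Category.assoc, emb_proj, Category.comp_id]
  have hmono := projEmb_mono G
  constructor
  · rintro _ ⟨n, rfl⟩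
    intro i x k
    rcases le_total n k with h | h
    · refine (hmono h i x k).trans (le_of_eq ?_)
      exact DFunLike.congr_fun (congrFun (hk k) i) x
    · have key : ∀ m, (fixProj G (k + m) ≫ fixEmb G (k + m)) ≫ fixProj G k = fixProj G k := by
        intro m
        have : ∀ m, ∃ p : chain G.obj (k + m) ⟶ chain G.obj k,
            fixProj G k = fixProj G (k + m) ≫ p := by
          intro m
          induction m with
          | zero => exact ⟨𝟙 _, (Category.comp_id _).symm⟩
          | succ m ih =>
            obtain ⟨p, hp⟩ := ih
            exact ⟨chainProj G.obj G.map (k + m) ≫ p, by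
              rw [← Category.assoc]
              change _ = (fixProj G (k + m + 1) ≫ chainProj G.obj G.map (k + m)) ≫ p
              rw [fixProj_succ]; exact hp⟩
        obtain ⟨p, hp⟩ := this m
        rw [hp, ← Category.assoc, hk]
      obtain ⟨m, rfl⟩ := Nat.exists_eq_add_of_le h
      exact le_of_eq (DFunLike.congr_fun (congrFun (key m) i) x)
  · intro f hf i x k
    refine (le_of_eq ?_).trans (hf ⟨k, rfl⟩ i x k)
    exact (DFunLike.congr_fun (congrFun (hk k) i) x).symm

/-- The canonical isomorphism `Fold : G (FIX G) ≅ FIX G`, with inverse `Unfold`. -/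
noncomputable def foldIso : G.obj (FIX G) ≅ FIX G where
  hom := fold G
  inv := unfold G
  hom_inv_id := by
    have h1 := isLUB_map_range (g := fun h : FIX G ⟶ G.obj (FIX G) => fold G ≫ h) (unfold_mono G)
      (scott_comp (f := fun h : FIX G ⟶ G.obj (FIX G) => (fold G, h)) (OCategory.comp_cont _ _ _)
        ((ScottContinuous.const _).prodMk .id))
      (isLUB_iSup_of_monotone (unfold_mono G))
    have h2 := isLUB_map_range (projEmb_mono G) (G.map_cont _ _) (isLUB_projEmb G)
    rw [G.map_id] at h2
    refine h1.unique ?_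
    convert h2 using 3 with n
    exact (G.map_comp (fixProj G n) (fixEmb G n)).symm
  inv_hom_id := by
    have h1 := isLUB_map_range (g := fun h : FIX G ⟶ G.obj (FIX G) => h ≫ fold G) (unfold_mono G)
      (scott_comp (f := fun h : FIX G ⟶ G.obj (FIX G) => (h, fold G)) (OCategory.comp_cont _ _ _)
        (ScottContinuous.id.prodMk (.const _)))
      (isLUB_iSup_of_monotone (unfold_mono G))
    have h2 := isLUB_projEmb G
    refine h1.unique ⟨?_, fun f hf => h2.2 ?_⟩
    · rintro _ ⟨n, rfl⟩
      exact h2.1 ⟨n + 1, rfl⟩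
    · rintro _ ⟨n, rfl⟩
      exact (projEmb_mono G n.le_succ).trans (hf ⟨n, rfl⟩)

end Fix

/-! ### Session types and functional types -/

/-- Polarities of session types; also used to index the two aspects of a denotation. -/
inductive Pol
  | neg
  | pos

/-- Labels of internal and external choices. -/
abbrev Label : Type := ℕ

/-- Type variables of polarity `p` in a context of polarised type variables. -/
inductive TVar : List Pol → Pol → Type
  | zero {Ξ p} : TVar (p :: Ξ) p
  | succ {Ξ p q} : TVar Ξ p → TVar (q :: Ξ) p

mutual

/-- Session types `Ξ ⊢ A type^p`, with de Bruijn indices for type variables. -/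
inductive STy : List Pol → Pol → Type
  /-- `1` -/
  | one {Ξ} : STy Ξ .pos
  /-- `α` -/
  | var {Ξ p} : TVar Ξ p → STy Ξ p
  /-- `ρα.A` -/
  | mu {Ξ p} : STy (p :: Ξ) p → STy Ξ p
  /-- `↓A` -/
  | down {Ξ} : STy Ξ .neg → STy Ξ .pos
  /-- `↑A` -/
  | up {Ξ} : STy Ξ .pos → STy Ξ .neg
  /-- `⊕{l : A l}` -/
  | plus {Ξ} (L : Finset Label) : (L → STy Ξ .pos) → STy Ξ .pos
  /-- `&{l : A l}` -/
  | amp {Ξ} (L : Finset Label) : (L → STy Ξ .neg) → STy Ξ .neg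
  /-- `A ⊗ B` -/
  | tensor {Ξ} : STy Ξ .pos → STy Ξ .pos → STy Ξ .pos
  /-- `A ⊸ B` -/
  | lolly {Ξ} : STy Ξ .pos → STy Ξ .neg → STy Ξ .neg
  /-- `τ ∧ A` -/
  | and {Ξ} : FTy → STy Ξ .pos → STy Ξ .pos
  /-- `τ ⊃ A` -/
  | imp {Ξ} : FTy → STy Ξ .neg → STy Ξ .neg

/-- Functional types: quoted processes and functions. -/
inductive FTy : Type
  /-- `{a : A ← Δ}`, the type of quoted processes providing `A` and using `Δ` -/
  | proc {p : Pol} : LCtx → STy [] p → FTy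
  /-- `τ → σ` -/
  | arrow : FTy → FTy → FTy

/-- Linear contexts: lists of closed session types, the channels being named by position. -/
inductive LCtx : Type
  | nil : LCtx
  | cons {p : Pol} : STy [] p → LCtx → LCtx

end

/-- Renamings under a binder. -/
def TVar.lift {Ξ Θ : List Pol} (ξ : ∀ q, TVar Ξ q → TVar Θ q) {p : Pol} :
    ∀ q, TVar (p :: Ξ) q → TVar (p :: Θ) q
  | _, .zero => .zero
  | _, .succ x => .succ (ξ _ x)

/-- Renaming of type variables. -/
def STy.ren {Ξ Θ : List Pol} {p : Pol} (A : STy Ξ p) (ξ : ∀ q, TVar Ξ q → TVar Θ q) :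
    STy Θ p :=
  match A with
  | .one => .one
  | .var x => .var (ξ _ x)
  | .mu A => .mu (A.ren (TVar.lift ξ))
  | .down A => .down (A.ren ξ)
  | .up A => .up (A.ren ξ)
  | .plus L A => .plus L fun l => (A l).ren ξ
  | .amp L A => .amp L fun l => (A l).ren ξ
  | .tensor A B => .tensor (A.ren ξ) (B.ren ξ)
  | .lolly A B => .lolly (A.ren ξ) (B.ren ξ)
  | .and τ A => .and τ (A.ren ξ)
  | .imp τ A => .imp τ (A.ren ξ)

/-- Substitutions under a binder. -/
def STy.liftSubst {Ξ Θ : List Pol} (σ : ∀ q, TVar Ξ q → STy Θ q) {p : Pol} :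
    ∀ q, TVar (p :: Ξ) q → STy (p :: Θ) q
  | _, .zero => .var .zero
  | _, .succ x => (σ _ x).ren fun _ => .succ

/-- Simultaneous substitution of session types for type variables. -/
def STy.subst {Ξ Θ : List Pol} {p : Pol} (A : STy Ξ p) (σ : ∀ q, TVar Ξ q → STy Θ q) :
    STy Θ p :=
  match A with
  | .one => .one
  | .var x => σ _ x
  | .mu A => .mu (A.subst (STy.liftSubst σ))
  | .down A => .down (A.subst σ)
  | .up A => .up (A.subst σ)
  | .plus L A => .plus L fun l => (A l).subst σ
  | .amp L A => .amp L fun l => (A l).subst σ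
  | .tensor A B => .tensor (A.subst σ) (B.subst σ)
  | .lolly A B => .lolly (A.subst σ) (B.subst σ)
  | .and τ A => .and τ (A.subst σ)
  | .imp τ A => .imp τ (A.subst σ)

/-- The substitution `[B/α]`. -/
def STy.single {p : Pol} (B : STy [] p) : ∀ q, TVar [p] q → STy [] q
  | _, .zero => B

/-- The unfolding `[ρα.A/α]A` of the recursive type `ρα.A`. -/
def STy.unfolding {p : Pol} (A : STy [p] p) : STy [] p := A.subst (STy.single (.mu A))

/-- Concatenation of linear contexts. -/
def LCtx.append : LCtx → LCtx → LCtx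
  | .nil, Δ => Δ
  | .cons A Δ₁, Δ => .cons A (Δ₁.append Δ)

/-! ### Denotations of types -/

/-- Semantic environments for type variables: each variable stands for a pair of domains, its
negative and positive aspects. -/
def Env : List Pol → Type 1
  | [] => PUnit
  | _ :: Ξ => (Pol → Dom) × Env Ξ

@[reducible]
noncomputable def Env.category : ∀ Ξ : List Pol, Category.{0} (Env Ξ)
  | [] =>
    { Hom := fun _ _ => PUnit
      id := fun _ => PUnit.unit
      comp := fun _ _ => PUnit.unit }
  | _ :: Ξ =>
    letI := Env.category Ξ
    inferInstanceAs (Category ((Pol → Dom) × Env Ξ))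

attribute [instance] Env.category

@[reducible]
noncomputable def Env.ocategory : ∀ Ξ : List Pol, OCategory (Env Ξ)
  | [] =>
    { homCPO := fun _ _ => inferInstanceAs (CompletePartialOrder PUnit)
      comp_cont := fun X Y Z => by exact ScottContinuous.const (α := PUnit × PUnit) PUnit.unit }
  | _ :: Ξ =>
    letI := Env.ocategory Ξ
    inferInstanceAs (OCategory ((Pol → Dom) × Env Ξ))

attribute [instance] Env.ocategory

/-- The unique environment for the empty context. -/
def Env.nil : Env [] := PUnit.unit

/-- Type variables denote projections. -/
noncomputable def TVar.den : ∀ {Ξ : List Pol} {p : Pol}, TVar Ξ p → Pol → LCFunctor (Env Ξ) Dom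
  | _ :: Ξ, _, .zero, q => (LCFunctor.fst (C := Pol → Dom) (D := Env Ξ)).comp (LCFunctor.eval q)
  | _ :: Ξ, _, .succ x, q => (LCFunctor.snd (C := Pol → Dom) (D := Env Ξ)).comp (x.den q)

mutual

/-- The positive and negative aspects of a session type. -/
noncomputable def STy.den {Ξ : List Pol} {p : Pol} : STy Ξ p → Pol → LCFunctor (Env Ξ) Dom
  | .one, .neg => .const Dom.one
  | .one, .pos => .const ⟨WithBot PUnit⟩
  | .var x, q => x.den q
  | .mu A, q => LCFunctor.fix (C := Env Ξ) (fun r => A.den r) q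
  | .down A, .neg => A.den .neg
  | .down A, .pos => (A.den .pos).lift
  | .up A, .neg => (A.den .neg).lift
  | .up A, .pos => A.den .pos
  | .plus _ A, .neg => .pi fun l => (A l).den .neg
  | .plus _ A, .pos => .sum fun l => (A l).den .pos
  | .amp _ A, .neg => .sum fun l => (A l).den .neg
  | .amp _ A, .pos => .pi fun l => (A l).den .pos
  | .tensor A B, .neg => (A.den .neg).prod (B.den .neg)
  | .tensor A B, .pos => ((A.den .pos).prod (B.den .pos)).lift
  | .lolly A B, .neg => ((A.den .pos).prod (B.den .neg)).lift
  | .lolly A B, .pos => (A.den .neg).prod (B.den .pos)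
  | .and _ A, .neg => A.den .neg
  | .and τ A, .pos => ((LCFunctor.const τ.den).prod (A.den .pos)).lift
  | .imp τ A, .neg => ((LCFunctor.const τ.den).prod (A.den .neg)).lift
  | .imp _ A, .pos => A.den .pos

/-- The domain of values of a functional type. -/
noncomputable def FTy.den : FTy → Dom
  | .proc Δ A => ⟨WithBot ((Δ.den .pos × (A.den .neg).obj Env.nil) →ˢ
      (Δ.den .neg × (A.den .pos).obj Env.nil))⟩
  | .arrow τ σ => ⟨τ.den →! σ.den⟩

/-- The product of the aspects of the session types in a linear context. -/
noncomputable def LCtx.den : LCtx → Pol → Dom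
  | .nil, _ => Dom.one
  | .cons A Δ, q => ⟨(A.den q).obj Env.nil × Δ.den q⟩

end

/-- The aspects of a closed session type. -/
noncomputable abbrev STy.dom {p : Pol} (A : STy [] p) (q : Pol) : Dom := (A.den q).obj Env.nil

theorem fixAux_congr {ι : Type} {C : Type 1} [Category.{0} C] [OCategory C]
    {obj : C → (ι → Dom) → ι → Dom}
    {map₁ map₁' : ∀ X {D E : ι → Dom}, (D ⟶ E) → (obj X D ⟶ obj X E)}
    (h : @map₁ = @map₁')
    {T : ∀ {X Y : C} {D E : ι → Dom}, (X ⟶ Y) → (D ⟶ E) → (obj X D ⟶ obj Y E)}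
    (a a' b c d) (i : ι) :
    fixAux obj map₁ T a b c d i = fixAux obj map₁' T a' b c d i := by
  subst h
  rfl

theorem LCFunctor.fix_comp {ι : Type} {B C : Type 1} [Category.{0} B] [Category.{0} C]
    [OCategory B] [OCategory C] (S : LCFunctor B C) (F : ι → LCFunctor ((ι → Dom) × C) Dom)
    (i : ι) :
    LCFunctor.fix (fun j => (LCFunctor.pair LCFunctor.fst (LCFunctor.snd.comp S)).comp (F j)) i =
      S.comp (LCFunctor.fix F i) := by
  have hmap : ∀ X : B, ∀ {D E : ι → Dom} (g : D ⟶ E),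
      (LCFunctor.tuple F).map (X := (D, S.obj X)) (Y := (E, S.obj X)) (g, 𝟙 (S.obj X)) =
        (LCFunctor.tuple F).map (X := (D, S.obj X)) (Y := (E, S.obj X)) (g, S.map (𝟙 X)) := by
    intro X D E g
    rw [S.map_id]
  refine (fixAux_congr (C := B) (obj := fun X => ((LCFunctor.tuple F).sec (S.obj X)).obj)
    (map₁ := fun X {D E} g =>
      (LCFunctor.tuple F).map (X := (D, S.obj X)) (Y := (E, S.obj X)) (g, S.map (𝟙 X)))
    (map₁' := fun X {D E} g =>
      (LCFunctor.tuple F).map (X := (D, S.obj X)) (Y := (E, S.obj X)) (g, 𝟙 (S.obj X)))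
    (T := fun {X Y D E} f g => (LCFunctor.tuple F).map (X := (D, S.obj X)) (Y := (E, S.obj Y))
      (g, S.map f)) ?_ (fun _ _ _ _ => rfl) hmap
      (fun X D => ?_) (fun {X Y Z D E E'} f g h k => ?_) (fun X Y D E => ?_) i)
  · funext X D E g
    exact (hmap X g).symm
  · rw [S.map_id]
    exact (LCFunctor.tuple F).map_id (D, S.obj X)
  · rw [S.map_comp]
    exact (LCFunctor.tuple F).map_comp (X := (D, S.obj X)) (Y := (E, S.obj Y)) (Z := (E', S.obj Z))
      (h, S.map f) (k, S.map g)
  · exact scott_comp (f := fun p : (X ⟶ Y) × (D ⟶ E) =>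
        ((p.2, S.map p.1) : ((D, S.obj X) : (ι → Dom) × C) ⟶ (E, S.obj Y)))
      ((LCFunctor.tuple F).map_cont (D, S.obj X) (E, S.obj Y))
      (ScottContinuous.snd.prodMk (scott_comp (S.map_cont X Y) .fst))

theorem STy.ren_den {Ξ Θ : List Pol} {p : Pol} (A : STy Ξ p) (ξ : ∀ q, TVar Ξ q → TVar Θ q)
    (S : LCFunctor (Env Θ) (Env Ξ)) (h : ∀ q x r, (ξ q x).den r = S.comp (x.den r)) (r : Pol) :
    (A.ren ξ).den r = S.comp (A.den r) :=
  match A, r with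
  | .one, .neg => rfl
  | .one, .pos => rfl
  | .var x, r => h _ x r
  | .mu (p := p) A, r => by
    have ih := fun r => STy.ren_den A (TVar.lift ξ)
      ((LCFunctor.fst (C := Pol → Dom)).pair (LCFunctor.snd.comp S)) (fun q x r => by
        cases x with
        | zero => rfl
        | succ x => exact congrArg (LCFunctor.comp LCFunctor.snd) (h q x r)) r
    exact (congrArg (fun F => LCFunctor.fix (C := Env Θ) F r) (funext ih)).trans
      (LCFunctor.fix_comp S (fun r => A.den r) r)
  | .down A, .neg => STy.ren_den A ξ S h .neg
  | .down A, .pos => congrArg LCFunctor.lift (STy.ren_den A ξ S h .pos)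
  | .up A, .neg => congrArg LCFunctor.lift (STy.ren_den A ξ S h .neg)
  | .up A, .pos => STy.ren_den A ξ S h .pos
  | .plus L A, .neg => congrArg LCFunctor.pi (funext fun l => STy.ren_den (A l) ξ S h .neg)
  | .plus L A, .pos => congrArg LCFunctor.sum (funext fun l => STy.ren_den (A l) ξ S h .pos)
  | .amp L A, .neg => congrArg LCFunctor.sum (funext fun l => STy.ren_den (A l) ξ S h .neg)
  | .amp L A, .pos => congrArg LCFunctor.pi (funext fun l => STy.ren_den (A l) ξ S h .pos)
  | .tensor A B, .neg => congrArg₂ LCFunctor.prod (STy.ren_den A ξ S h .neg)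
      (STy.ren_den B ξ S h .neg)
  | .tensor A B, .pos => congrArg₂ (fun F G => (LCFunctor.prod F G).lift)
      (STy.ren_den A ξ S h .pos) (STy.ren_den B ξ S h .pos)
  | .lolly A B, .neg => congrArg₂ (fun F G => (LCFunctor.prod F G).lift)
      (STy.ren_den A ξ S h .pos) (STy.ren_den B ξ S h .neg)
  | .lolly A B, .pos => congrArg₂ LCFunctor.prod (STy.ren_den A ξ S h .neg)
      (STy.ren_den B ξ S h .pos)
  | .and τ A, .neg => STy.ren_den A ξ S h .neg
  | .and τ A, .pos => congrArg (fun F => (LCFunctor.prod (.const τ.den) F).lift)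
      (STy.ren_den A ξ S h .pos)
  | .imp τ A, .neg => congrArg (fun F => (LCFunctor.prod (.const τ.den) F).lift)
      (STy.ren_den A ξ S h .neg)
  | .imp τ A, .pos => STy.ren_den A ξ S h .pos

/-- Substitution of session types denotes composition of functors. -/
theorem STy.subst_den {Ξ Θ : List Pol} {p : Pol} (A : STy Ξ p) (σ : ∀ q, TVar Ξ q → STy Θ q)
    (S : LCFunctor (Env Θ) (Env Ξ)) (h : ∀ q x r, (σ q x).den r = S.comp (x.den r)) (r : Pol) :
    (A.subst σ).den r = S.comp (A.den r) :=
  match A, r with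
  | .one, .neg => rfl
  | .one, .pos => rfl
  | .var x, r => h _ x r
  | .mu (p := p) A, r => by
    have ih := fun r => STy.subst_den A (STy.liftSubst σ)
      ((LCFunctor.fst (C := Pol → Dom)).pair (LCFunctor.snd.comp S)) (fun q x r => by
        cases x with
        | zero => rfl
        | succ x =>
          exact (STy.ren_den (σ q x) (Θ := p :: Θ) (fun _ => .succ)
            (LCFunctor.snd (C := Pol → Dom) (D := Env Θ)) (fun _ _ _ => rfl) r).trans
            (congrArg (LCFunctor.comp LCFunctor.snd) (h q x r))) r
    exact (congrArg (fun F => LCFunctor.fix (C := Env Θ) F r) (funext ih)).trans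
      (LCFunctor.fix_comp S (fun r => A.den r) r)
  | .down A, .neg => STy.subst_den A σ S h .neg
  | .down A, .pos => congrArg LCFunctor.lift (STy.subst_den A σ S h .pos)
  | .up A, .neg => congrArg LCFunctor.lift (STy.subst_den A σ S h .neg)
  | .up A, .pos => STy.subst_den A σ S h .pos
  | .plus L A, .neg => congrArg LCFunctor.pi (funext fun l => STy.subst_den (A l) σ S h .neg)
  | .plus L A, .pos => congrArg LCFunctor.sum (funext fun l => STy.subst_den (A l) σ S h .pos)
  | .amp L A, .neg => congrArg LCFunctor.sum (funext fun l => STy.subst_den (A l) σ S h .neg)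
  | .amp L A, .pos => congrArg LCFunctor.pi (funext fun l => STy.subst_den (A l) σ S h .pos)
  | .tensor A B, .neg => congrArg₂ LCFunctor.prod (STy.subst_den A σ S h .neg)
      (STy.subst_den B σ S h .neg)
  | .tensor A B, .pos => congrArg₂ (fun F G => (LCFunctor.prod F G).lift)
      (STy.subst_den A σ S h .pos) (STy.subst_den B σ S h .pos)
  | .lolly A B, .neg => congrArg₂ (fun F G => (LCFunctor.prod F G).lift)
      (STy.subst_den A σ S h .pos) (STy.subst_den B σ S h .neg)
  | .lolly A B, .pos => congrArg₂ LCFunctor.prod (STy.subst_den A σ S h .neg)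
      (STy.subst_den B σ S h .pos)
  | .and τ A, .neg => STy.subst_den A σ S h .neg
  | .and τ A, .pos => congrArg (fun F => (LCFunctor.prod (.const τ.den) F).lift)
      (STy.subst_den A σ S h .pos)
  | .imp τ A, .neg => congrArg (fun F => (LCFunctor.prod (.const τ.den) F).lift)
      (STy.subst_den A σ S h .neg)
  | .imp τ A, .pos => STy.subst_den A σ S h .pos

/-- For fixed `X`, the locally continuous endofunctor on pairs of aspects denoted by `A`. -/
noncomputable def STy.functorAt {Ξ : List Pol} {p : Pol} (A : STy (p :: Ξ) p) (X : Env Ξ) :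
    LCFunctor (Pol → Dom) (Pol → Dom) :=
  LCFunctor.sec (B := Pol → Dom) (C := Env Ξ)
    (LCFunctor.tuple (C := (Pol → Dom) × Env Ξ) fun r => A.den r) X

theorem STy.mu_den_obj {Ξ : List Pol} {p : Pol} (A : STy (p :: Ξ) p) (X : Env Ξ) (q : Pol) :
    ((STy.mu A).den q).obj X = FIX (A.functorAt X) q := rfl

/-- The locally continuous endofunctor on pairs of aspects denoted by `A` in one variable. -/
noncomputable def STy.functor {p : Pol} (A : STy [p] p) :
    LCFunctor (Pol → Dom) (Pol → Dom) := A.functorAt Env.nil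

theorem STy.mu_dom {p : Pol} (A : STy [p] p) (q : Pol) :
    (STy.mu A).dom q = FIX A.functor q := rfl

/-- The environment transformer of a one-variable substitution. -/
noncomputable def STy.singleEnv {Ξ : List Pol} {p : Pol} (B : STy Ξ p) :
    LCFunctor (Env Ξ) (Env (p :: Ξ)) :=
  LCFunctor.pair (D := Pol → Dom) (E := Env Ξ) (LCFunctor.tuple fun r => B.den r) LCFunctor.ident

theorem STy.unfolding_dom {p : Pol} (A : STy [p] p) (q : Pol) :
    A.unfolding.dom q = A.functor.obj (FIX A.functor) q := by
  have h := STy.subst_den A (STy.single (.mu A)) (STy.singleEnv (STy.mu A))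
    (fun q x r => by
      cases x with
      | zero => rfl
      | succ x => exact nomatch x) q
  exact congrArg (fun F : LCFunctor (Env []) Dom => F.obj Env.nil) h

/-- `Fold`, from the unfolding of a recursive type to the recursive type. -/
noncomputable def STy.fold {p : Pol} (A : STy [p] p) (q : Pol) :
    A.unfolding.dom q →! (STy.mu A).dom q :=
  eqToHom (A.unfolding_dom q) ≫ (foldIso A.functor).hom q

/-- `Unfold`, the inverse of `Fold`. -/
noncomputable def STy.unfold {p : Pol} (A : STy [p] p) (q : Pol) :
    (STy.mu A).dom q →! A.unfolding.dom q :=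
  (foldIso A.functor).inv q ≫ eqToHom (A.unfolding_dom q).symm

/-! ### Syntax of terms and processes -/

/-- Functional variables of type `τ` in a functional context. -/
inductive Var : List FTy → FTy → Type
  | zero {Ψ τ} : Var (τ :: Ψ) τ
  | succ {Ψ τ σ} : Var Ψ τ → Var (σ :: Ψ) τ

/-- Reorderings of linear contexts. -/
inductive LCtx.Perm : LCtx → LCtx → Type
  | nil : Perm .nil .nil
  | cons {p Δ Δ'} (A : STy [] p) : Perm Δ Δ' → Perm (.cons A Δ) (.cons A Δ')
  | swap {p q Δ} (A : STy [] p) (B : STy [] q) :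
      Perm (.cons A (.cons B Δ)) (.cons B (.cons A Δ))
  | trans {Δ Δ' Δ''} : Perm Δ Δ' → Perm Δ' Δ'' → Perm Δ Δ''

mutual

/-- Typing derivations `Ψ ⊢ M : τ` of functional terms, with de Bruijn indices for variables. -/
inductive Tm : List FTy → FTy → Type
  /-- `a ← {P} ← Δ` -/
  | quote {Ψ Δ p} {A : STy [] p} : Proc Ψ Δ A → Tm Ψ (.proc Δ A)
  /-- `x` -/
  | var {Ψ τ} : Var Ψ τ → Tm Ψ τ
  /-- `fix x.M` -/
  | fix {Ψ τ} : Tm (τ :: Ψ) τ → Tm Ψ τ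
  /-- `λx:τ.M` -/
  | lam {Ψ τ σ} : Tm (τ :: Ψ) σ → Tm Ψ (.arrow τ σ)
  /-- `M N` -/
  | app {Ψ τ σ} : Tm Ψ (.arrow τ σ) → Tm Ψ τ → Tm Ψ σ

/-- Typing derivations `Ψ ; Δ ⊢ P :: c : C` of processes. The channels used are named by their
position in `Δ`; in the rules acting on a used channel, it is the head of the context. -/
inductive Proc : List FTy → LCtx → {p : Pol} → STy [] p → Type
  /-- exchange -/
  | exch {Ψ Δ Δ' p} {C : STy [] p} : LCtx.Perm Δ Δ' → Proc Ψ Δ C → Proc Ψ Δ' C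
  /-- `a → b` -/
  | fwd {Ψ p} (A : STy [] p) : Proc Ψ (.cons A .nil) A
  /-- `a : P; Q` -/
  | cut {Ψ Δ₁ Δ₂ p q} {A : STy [] p} {C : STy [] q} :
      Proc Ψ Δ₁ A → Proc Ψ (.cons A Δ₂) C → Proc Ψ (Δ₁.append Δ₂) C
  /-- `close a` -/
  | close {Ψ} : Proc Ψ .nil .one
  /-- `wait a; P` -/
  | wait {Ψ Δ p} {C : STy [] p} : Proc Ψ Δ C → Proc Ψ (.cons .one Δ) C
  /-- `send a shift; P`, providing `a : ↓A` -/
  | downR {Ψ Δ} {A : STy [] .neg} : Proc Ψ Δ A → Proc Ψ Δ (.down A)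
  /-- `shift ← recv a; P`, using `a : ↓A` -/
  | downL {Ψ Δ p} {A : STy [] .neg} {C : STy [] p} :
      Proc Ψ (.cons A Δ) C → Proc Ψ (.cons (.down A) Δ) C
  /-- `shift ← recv a; P`, providing `a : ↑A` -/
  | upR {Ψ Δ} {A : STy [] .pos} : Proc Ψ Δ A → Proc Ψ Δ (.up A)
  /-- `send a shift; P`, using `a : ↑A` -/
  | upL {Ψ Δ p} {A : STy [] .pos} {C : STy [] p} :
      Proc Ψ (.cons A Δ) C → Proc Ψ (.cons (.up A) Δ) C
  /-- `a.k; P`, providing `a : ⊕{l : A l}` -/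
  | plusR {Ψ Δ} {L : Finset Label} {A : L → STy [] .pos} (k : L) :
      Proc Ψ Δ (A k) → Proc Ψ Δ (.plus L A)
  /-- `case a {l ⇒ P l}`, using `a : ⊕{l : A l}` -/
  | plusL {Ψ Δ p} {L : Finset Label} {A : L → STy [] .pos} {C : STy [] p} :
      (∀ l, Proc Ψ (.cons (A l) Δ) C) → Proc Ψ (.cons (.plus L A) Δ) C
  /-- `case a {l ⇒ P l}`, providing `a : &{l : A l}` -/
  | ampR {Ψ Δ} {L : Finset Label} {A : L → STy [] .neg} :
      (∀ l, Proc Ψ Δ (A l)) → Proc Ψ Δ (.amp L A)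
  /-- `a.k; P`, using `a : &{l : A l}` -/
  | ampL {Ψ Δ p} {L : Finset Label} {A : L → STy [] .neg} {C : STy [] p} (k : L) :
      Proc Ψ (.cons (A k) Δ) C → Proc Ψ (.cons (.amp L A) Δ) C
  /-- `send a b; P`, providing `a : B ⊗ A` and using `b : B` -/
  | tensorR {Ψ Δ} {B A : STy [] .pos} : Proc Ψ Δ A → Proc Ψ (.cons B Δ) (.tensor B A)
  /-- `b ← recv a; P`, using `a : B ⊗ A`; in the premise `a : A` comes first and `b : B` second -/
  | tensorL {Ψ Δ p} {B A : STy [] .pos} {C : STy [] p} :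
      Proc Ψ (.cons A (.cons B Δ)) C → Proc Ψ (.cons (.tensor B A) Δ) C
  /-- `b ← recv a; P`, providing `a : B ⊸ A` -/
  | lollyR {Ψ Δ} {B : STy [] .pos} {A : STy [] .neg} :
      Proc Ψ (.cons B Δ) A → Proc Ψ Δ (.lolly B A)
  /-- `send a b; P`, using `a : B ⊸ A` first and `b : B` second -/
  | lollyL {Ψ Δ p} {B : STy [] .pos} {A : STy [] .neg} {C : STy [] p} :
      Proc Ψ (.cons A Δ) C → Proc Ψ (.cons (.lolly B A) (.cons B Δ)) C
  /-- `send a M; P`, providing `a : τ ∧ A` -/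
  | andR {Ψ Δ τ} {A : STy [] .pos} : Tm Ψ τ → Proc Ψ Δ A → Proc Ψ Δ (.and τ A)
  /-- `x ← recv a; P`, using `a : τ ∧ A` -/
  | andL {Ψ Δ τ p} {A : STy [] .pos} {C : STy [] p} :
      Proc (τ :: Ψ) (.cons A Δ) C → Proc Ψ (.cons (.and τ A) Δ) C
  /-- `x ← recv a; P`, providing `a : τ ⊃ A` -/
  | impR {Ψ Δ τ} {A : STy [] .neg} : Proc (τ :: Ψ) Δ A → Proc Ψ Δ (.imp τ A)
  /-- `send a M; P`, using `a : τ ⊃ A` -/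
  | impL {Ψ Δ τ p} {A : STy [] .neg} {C : STy [] p} :
      Tm Ψ τ → Proc Ψ (.cons A Δ) C → Proc Ψ (.cons (.imp τ A) Δ) C
  /-- providing `a : ρα.A`: `send a unfold; P` if it is positive, `unfold ← recv a; P` if it is
  negative -/
  | muR {Ψ Δ p} {A : STy [p] p} : Proc Ψ Δ A.unfolding → Proc Ψ Δ (.mu A)
  /-- using `a : ρα.A`: `unfold ← recv a; P` if it is positive, `send a unfold; P` if it is
  negative -/
  | muL {Ψ Δ p q} {A : STy [p] p} {C : STy [] q} :
      Proc Ψ (.cons A.unfolding Δ) C → Proc Ψ (.cons (.mu A) Δ) C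
  /-- `a ← {M} ← Δ` -/
  | unquote {Ψ Δ p} {A : STy [] p} : Tm Ψ (.proc Δ A) → Proc Ψ Δ A

end

/-! ### Substitution of functional terms -/

/-- Renamings of functional variables. -/
abbrev Ren (Ψ Φ : List FTy) : Type := ∀ τ, Var Ψ τ → Var Φ τ

/-- Renamings under a binder. -/
def Ren.lift {Ψ Φ : List FTy} (ξ : Ren Ψ Φ) {σ : FTy} : Ren (σ :: Ψ) (σ :: Φ)
  | _, .zero => .zero
  | _, .succ x => .succ (ξ _ x)

mutual

/-- Renaming of functional variables in terms. -/
def Tm.ren {Ψ Φ : List FTy} {τ : FTy} (M : Tm Ψ τ) (ξ : Ren Ψ Φ) : Tm Φ τ :=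
  match M with
  | .quote P => .quote (P.ren ξ)
  | .var x => .var (ξ _ x)
  | .fix M => .fix (M.ren ξ.lift)
  | .lam M => .lam (M.ren ξ.lift)
  | .app M N => .app (M.ren ξ) (N.ren ξ)

/-- Renaming of functional variables in processes. -/
def Proc.ren {Ψ Φ : List FTy} {Δ : LCtx} {p : Pol} {C : STy [] p} (P : Proc Ψ Δ C)
    (ξ : Ren Ψ Φ) : Proc Φ Δ C :=
  match P with
  | .exch π P => .exch π (P.ren ξ)
  | .fwd A => .fwd A
  | .cut P Q => .cut (P.ren ξ) (Q.ren ξ)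
  | .close => .close
  | .wait P => .wait (P.ren ξ)
  | .downR P => .downR (P.ren ξ)
  | .downL P => .downL (P.ren ξ)
  | .upR P => .upR (P.ren ξ)
  | .upL P => .upL (P.ren ξ)
  | .plusR k P => .plusR k (P.ren ξ)
  | .plusL P => .plusL fun l => (P l).ren ξ
  | .ampR P => .ampR fun l => (P l).ren ξ
  | .ampL k P => .ampL k (P.ren ξ)
  | .tensorR P => .tensorR (P.ren ξ)
  | .tensorL P => .tensorL (P.ren ξ)
  | .lollyR P => .lollyR (P.ren ξ)
  | .lollyL P => .lollyL (P.ren ξ)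
  | .andR M P => .andR (M.ren ξ) (P.ren ξ)
  | .andL P => .andL (P.ren ξ.lift)
  | .impR P => .impR (P.ren ξ.lift)
  | .impL M P => .impL (M.ren ξ) (P.ren ξ)
  | .muR P => .muR (P.ren ξ)
  | .muL P => .muL (P.ren ξ)
  | .unquote M => .unquote (M.ren ξ)

end

/-- Substitutions of functional terms for functional variables. -/
abbrev Sub (Ψ Φ : List FTy) : Type := ∀ τ, Var Ψ τ → Tm Φ τ

/-- Substitutions under a binder. -/
def Sub.lift {Ψ Φ : List FTy} (s : Sub Ψ Φ) {σ : FTy} : Sub (σ :: Ψ) (σ :: Φ)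
  | _, .zero => .var .zero
  | _, .succ x => (s _ x).ren fun _ => .succ

/-- The substitution `[M/x]`. -/
def Sub.single {Ψ : List FTy} {σ : FTy} (M : Tm Ψ σ) : Sub (σ :: Ψ) Ψ
  | _, .zero => M
  | _, .succ x => .var x

mutual

/-- Simultaneous capture-avoiding substitution in terms. -/
def Tm.subst {Ψ Φ : List FTy} {τ : FTy} (M : Tm Ψ τ) (s : Sub Ψ Φ) : Tm Φ τ :=
  match M with
  | .quote P => .quote (P.subst s)
  | .var x => s _ x
  | .fix M => .fix (M.subst s.lift)
  | .lam M => .lam (M.subst s.lift)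
  | .app M N => .app (M.subst s) (N.subst s)

/-- Simultaneous capture-avoiding substitution in processes. -/
def Proc.subst {Ψ Φ : List FTy} {Δ : LCtx} {p : Pol} {C : STy [] p} (P : Proc Ψ Δ C)
    (s : Sub Ψ Φ) : Proc Φ Δ C :=
  match P with
  | .exch π P => .exch π (P.subst s)
  | .fwd A => .fwd A
  | .cut P Q => .cut (P.subst s) (Q.subst s)
  | .close => .close
  | .wait P => .wait (P.subst s)
  | .downR P => .downR (P.subst s)
  | .downL P => .downL (P.subst s)
  | .upR P => .upR (P.subst s)
  | .upL P => .upL (P.subst s)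
  | .plusR k P => .plusR k (P.subst s)
  | .plusL P => .plusL fun l => (P l).subst s
  | .ampR P => .ampR fun l => (P l).subst s
  | .ampL k P => .ampL k (P.subst s)
  | .tensorR P => .tensorR (P.subst s)
  | .tensorL P => .tensorL (P.subst s)
  | .lollyR P => .lollyR (P.subst s)
  | .lollyL P => .lollyL (P.subst s)
  | .andR M P => .andR (M.subst s) (P.subst s)
  | .andL P => .andL (P.subst s.lift)
  | .impR P => .impR (P.subst s.lift)
  | .impL M P => .impL (M.subst s) (P.subst s)
  | .muR P => .muR (P.subst s)
  | .muL P => .muL (P.subst s)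
  | .unquote M => .unquote (M.subst s)

end

/-- `[M/x]Q` for the most recently bound functional variable `x`. -/
def Proc.inst {Ψ : List FTy} {σ : FTy} {Δ : LCtx} {p : Pol} {C : STy [] p}
    (Q : Proc (σ :: Ψ) Δ C) (M : Tm Ψ σ) : Proc Ψ Δ C := Q.subst (Sub.single M)

/-! ### The semantic operations -/

namespace Sem

variable {U V X Y A A' B B' C C' D D' : Type} [CompletePartialOrder U] [CompletePartialOrder V]
  [CompletePartialOrder X] [CompletePartialOrder Y] [CompletePartialOrder A]
  [CompletePartialOrder A'] [CompletePartialOrder B] [CompletePartialOrder B']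
  [CompletePartialOrder C] [CompletePartialOrder C'] [CompletePartialOrder D]
  [CompletePartialOrder D']

/-- The continuous map sending `a` at index `k` to the family `(k : a, l ≠ k : ⊥)`. -/
def single {ι : Type} [DecidableEq ι] {F : ι → Type} [∀ i, CompletePartialOrder (F i)] (k : ι) :
    F k →ˢ (∀ i, F i) :=
  ⟨fun a => Function.update ⊥ k a, scott_pi fun i => by
    by_cases h : i = k
    · subst h
      simp
    · simp [h]⟩

/-- The continuous map sending `a` at index `k` to the tagged element `(k, ↑a)`. -/
def tag {ι : Type} {F : ι → Type} [∀ i, CompletePartialOrder (F i)] (k : ι) :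
    F k →ˢ WithBot (Σ i, F i) :=
  ⟨fun a => ((⟨k, a⟩ : Σ i, F i) : WithBot (Σ i, F i)), scott_coe (scott_sigmaMk k)⟩

/-- Lifting, `↑`. -/
def up : A →ˢ WithBot A := ⟨fun a => a, scott_coe ScottContinuous.id⟩

theorem lifted_scott {f : WithBot A → B} (g : A →ˢ B) (h : f = lifted g) : ScottContinuous f := by
  have := scott_lifted (f := fun (_ : WithBot A) a => g a) (scott_comp g.scott .snd) .id
  subst h
  exact this

/-- The left inverse `↓` of `↑`. -/
def down : WithBot A →ˢ A := ⟨lifted fun a => a, lifted_scott ⟨_, .id⟩ rfl⟩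

/-- `u ↦ strict (v ↦ f (v, u))` -/
noncomputable def lam (f : A × U →ˢ B) : U →ˢ (A →! B) where
  toFun u := ⟨⟨fun v => strictIn v (f (v, u)), by have := f.scott; fun_prop⟩, by
    simp [strictIn]⟩
  cont := StrictMap.scott_into fun v => by
    change ScottContinuous fun u => strictIn v (f (v, u))
    have := f.scott
    fun_prop

/-- `u ↦ f u (g u)` -/
noncomputable def app (f : U →ˢ (A →! B)) (g : U →ˢ A) : U →ˢ B :=
  ⟨fun u => f u (g u), scott_strict_app f.scott g.scott⟩

/-- The parametrised fixed point, `u ↦ lfp (v ↦ f (v, u))`. -/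
noncomputable def fix (f : A × U →ˢ A) : U →ˢ A :=
  ScottMap.dagger ⟨fun p => f (p.2, p.1), by have := f.scott; fun_prop⟩

/-- `(a⁺, b⁻) ↦ (a⁻, b⁺)` -/
noncomputable def fwd : U →ˢ ((A × PUnit) × B →ˢ (B × PUnit) × A) :=
  ScottMap.lam₂ (fun _ x => ((x.2, PUnit.unit), x.1.1)) (by fun_prop)

/-- The product `f u × g u`, arranged for taking the trace over `a⁻ × a⁺`. Here `X`, `D` are the
inputs and `Y`, `D'` the outputs on the used channels, `C` and `C'` the input and the output on the
provided channel, and `A`, `A'` the negative and positive aspects of `a`. -/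
noncomputable def par (f : U →ˢ (X × A →ˢ Y × A')) (g : U →ˢ ((A' × D) × C →ˢ (A × D') × C')) :
    U →ˢ (((X × D) × C) × (A × A') →ˢ ((Y × D') × C') × (A × A')) :=
  ScottMap.lam₂ (fun u w =>
    let y := f u (w.1.1.1, w.2.1)
    let z := g u ((w.2.2, w.1.1.2), w.1.2)
    (((y.1, z.1.2), z.2), (z.1.1, y.2))) (by
      have := f.scott; have := g.scott; fun_prop)

/-- The trace over `a⁻ × a⁺` of `f u × g u`. -/
noncomputable def cut (f : U →ˢ (X × A →ˢ Y × A')) (g : U →ˢ ((A' × D) × C →ˢ (A × D') × C')) :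
    U →ˢ ((X × D) × C →ˢ (Y × D') × C') :=
  ⟨fun u => ScottMap.trace (par f g u), scott_comp ScottMap.trace.scott (par f g).scott⟩

/-- The constant output `a⁺ = ∗`. -/
noncomputable def close : U →ˢ (PUnit × PUnit →ˢ PUnit × WithBot PUnit) :=
  ScottMap.lam₂ (fun _ _ => (PUnit.unit, (PUnit.unit : WithBot PUnit))) (by fun_prop)

/-- Waiting for `∗` on `a⁺`, with `a⁻ = ⊥`. -/
noncomputable def wait (f : U →ˢ (D × C →ˢ D' × C')) :
    U →ˢ ((WithBot PUnit × D) × C →ˢ (PUnit × D') × C') :=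
  ScottMap.lam₂ (fun u x =>
    let y := f u (x.1.2, x.2)
    strictIn x.1.1 ((PUnit.unit, y.1), y.2)) (by
      have := f.scott; fun_prop)

/-- Composition with `↑` on the output on the provided channel. -/
noncomputable def upOutR (f : U →ˢ (D × C →ˢ D' × C')) : U →ˢ (D × C →ˢ D' × WithBot C') :=
  ScottMap.lam₂ (fun u x => let y := f u x; (y.1, (y.2 : WithBot C'))) (by
    have := f.scott; fun_prop)

/-- Composition with `↓` on the input on the used channel, made strict in that channel. -/
noncomputable def downInL (f : U →ˢ ((A × D) × C →ˢ (A' × D') × C')) :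
    U →ˢ ((WithBot A × D) × C →ˢ (A' × D') × C') :=
  ScottMap.lam₂ (fun u x => strictIn x.1.1 (f u ((down x.1.1, x.1.2), x.2))) (by
    have := f.scott; have := (down (A := A)).scott; fun_prop)

/-- Composition with `↓` on the input on the provided channel, made strict in that channel. -/
noncomputable def downInR (f : U →ˢ (D × C →ˢ D' × C')) : U →ˢ (D × WithBot C →ˢ D' × C') :=
  ScottMap.lam₂ (fun u x => strictIn x.2 (f u (x.1, down x.2))) (by
    have := f.scott; have := (down (A := C)).scott; fun_prop)

/-- Composition with `↑` on the output on the used channel. -/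
noncomputable def upOutL (f : U →ˢ ((A × D) × C →ˢ (A' × D') × C')) :
    U →ˢ ((A × D) × C →ˢ (WithBot A' × D') × C') :=
  ScottMap.lam₂ (fun u x => let y := f u x; (((y.1.1 : WithBot A'), y.1.2), y.2)) (by
    have := f.scott; fun_prop)

section Choice

variable {ι : Type} [DecidableEq ι] {F G : ι → Type} [∀ i, CompletePartialOrder (F i)]
  [∀ i, CompletePartialOrder (G i)]

/-- Sending the label `k` on the provided channel. -/
noncomputable def plusR (k : ι) (f : U →ˢ (D × F k →ˢ D' × G k)) :
    U →ˢ (D × (∀ i, F i) →ˢ D' × WithBot (Σ i, G i)) :=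
  ScottMap.lam₂ (fun u x => let y := f u (x.1, x.2 k); (y.1, tag k y.2)) (by
    have := f.scott
    have h : ScottContinuous fun p : U × (D × (∀ i, F i)) => f p.1 (p.2.1, p.2.2 k) :=
      scott_app (by fun_prop) (.prodMk (by fun_prop) (scott_apply_comp k (by fun_prop)))
    exact (scott_comp .fst h).prodMk (scott_comp (tag k).scott (scott_comp .snd h)))

/-- Receiving a label on the used channel. -/
noncomputable def plusL (f : ∀ k, U →ˢ ((F k × D) × C →ˢ (G k × D') × C')) :
    U →ˢ ((WithBot (Σ i, F i) × D) × C →ˢ ((∀ i, G i) × D') × C') :=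
  ScottMap.lam₂ (fun u x => lifted (fun s : Σ i, F i =>
    let y := f s.1 u ((s.2, x.1.2), x.2)
    ((single (F := G) s.1 y.1.1, y.1.2), y.2)) x.1.1) (by
      refine scott_lifted (f := fun (p : U × ((WithBot (Σ i, F i) × D) × C)) (s : Σ i, F i) =>
        let y := f s.1 p.1 ((s.2, p.2.1.2), p.2.2)
        ((single (F := G) s.1 y.1.1, y.1.2), y.2)) ?_ (by fun_prop)
      refine scott_sigmaElim (f := fun (p : U × ((WithBot (Σ i, F i) × D) × C)) i (a : F i) =>
        let y := f i p.1 ((a, p.2.1.2), p.2.2)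
        ((single (F := G) i y.1.1, y.1.2), y.2)) fun i => ?_
      have := (f i).scott
      have := (single (F := G) i).scott
      fun_prop)

/-- Receiving a label on the provided channel. -/
noncomputable def ampR (f : ∀ k, U →ˢ (D × F k →ˢ D' × G k)) :
    U →ˢ (D × WithBot (Σ i, F i) →ˢ D' × (∀ i, G i)) :=
  ScottMap.lam₂ (fun u x => lifted (fun s : Σ i, F i =>
    let y := f s.1 u (x.1, s.2)
    (y.1, single (F := G) s.1 y.2)) x.2) (by
      refine scott_lifted (f := fun (p : U × (D × WithBot (Σ i, F i))) (s : Σ i, F i) =>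
        let y := f s.1 p.1 (p.2.1, s.2)
        (y.1, single (F := G) s.1 y.2)) ?_ (by fun_prop)
      refine scott_sigmaElim (f := fun (p : U × (D × WithBot (Σ i, F i))) i (a : F i) =>
        let y := f i p.1 (p.2.1, a)
        (y.1, single (F := G) i y.2)) fun i => ?_
      have := (f i).scott
      have := (single (F := G) i).scott
      fun_prop)

/-- Sending the label `k` on the used channel. -/
noncomputable def ampL (k : ι) (f : U →ˢ ((F k × D) × C →ˢ (G k × D') × C')) :
    U →ˢ (((∀ i, F i) × D) × C →ˢ (WithBot (Σ i, G i) × D') × C') :=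
  ScottMap.lam₂ (fun u x =>
    let y := f u ((x.1.1 k, x.1.2), x.2)
    ((tag k y.1.1, y.1.2), y.2)) (by
    have := f.scott
    have h : ScottContinuous fun p : U × (((∀ i, F i) × D) × C) =>
        f p.1 ((p.2.1.1 k, p.2.1.2), p.2.2) :=
      scott_app (by fun_prop) (.prodMk (.prodMk (scott_apply_comp k (by fun_prop)) (by fun_prop))
        (by fun_prop))
    exact ((scott_comp (tag k).scott (scott_comp .fst (scott_comp .fst h))).prodMk
      (scott_comp .snd (scott_comp .fst h))).prodMk (scott_comp .snd h))

end Choice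

/-- Sending a channel `b` on the provided channel; `B` and `B'` are the positive and negative
aspects of `b`. -/
noncomputable def tensorR (f : U →ˢ (D × C →ˢ D' × C')) :
    U →ˢ ((B × D) × (B' × C) →ˢ (B' × D') × WithBot (B × C')) :=
  ScottMap.lam₂ (fun u x =>
    let y := f u (x.1.2, x.2.2)
    ((x.2.1, y.1), ((x.1.1, y.2) : WithBot (B × C')))) (by
      have := f.scott; fun_prop)

/-- Receiving a channel on the used channel. -/
noncomputable def tensorL (f : U →ˢ ((A × B × D) × C →ˢ (A' × B' × D') × C')) :
    U →ˢ ((WithBot (B × A) × D) × C →ˢ ((B' × A') × D') × C') :=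
  ScottMap.lam₂ (fun u x => lifted (fun s : B × A =>
    let y := f u ((s.2, s.1, x.1.2), x.2)
    (((y.1.2.1, y.1.1), y.1.2.2), y.2)) x.1.1) (by
      have := f.scott; fun_prop)

/-- Receiving a channel on the provided channel. -/
noncomputable def lollyR (f : U →ˢ ((B × D) × C →ˢ (B' × D') × C')) :
    U →ˢ (D × WithBot (B × C) →ˢ D' × (B' × C')) :=
  ScottMap.lam₂ (fun u x => lifted (fun s : B × C =>
    let y := f u ((s.1, x.1), s.2)
    (y.1.2, (y.1.1, y.2))) x.2) (by
      have := f.scott; fun_prop)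

/-- Sending a channel on the used channel. -/
noncomputable def lollyL (f : U →ˢ ((A × D) × C →ˢ (A' × D') × C')) :
    U →ˢ (((B' × A) × B × D) × C →ˢ (WithBot (B × A') × B' × D') × C') :=
  ScottMap.lam₂ (fun u x =>
    let y := f u ((x.1.1.2, x.1.2.2), x.2)
    ((((x.1.2.1, y.1.1) : WithBot (B × A')), x.1.1.1, y.1.2), y.2)) (by
      have := f.scott; fun_prop)

/-- Sending the value `m u` on the provided channel, `⊥` if there is no value. -/
noncomputable def andR (m : U →ˢ V) (f : U →ˢ (D × C →ˢ D' × C')) :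
    U →ˢ (D × C →ˢ D' × WithBot (V × C')) :=
  ScottMap.lam₂ (fun u x =>
    let y := f u x
    strictIn (m u) (y.1, ((m u, y.2) : WithBot (V × C')))) (by
      have := m.scott; have := f.scott; fun_prop)

/-- Receiving a value on the used channel. -/
noncomputable def andL (f : V × U →ˢ ((A × D) × C →ˢ (A' × D') × C')) :
    U →ˢ ((WithBot (V × A) × D) × C →ˢ (A' × D') × C') :=
  ScottMap.lam₂ (fun u x => lifted (fun s : V × A => f (s.1, u) ((s.2, x.1.2), x.2)) x.1.1) (by
    have := f.scott; fun_prop)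

/-- Receiving a value on the provided channel. -/
noncomputable def impR (f : V × U →ˢ (D × C →ˢ D' × C')) :
    U →ˢ (D × WithBot (V × C) →ˢ D' × C') :=
  ScottMap.lam₂ (fun u x => lifted (fun s : V × C => f (s.1, u) (x.1, s.2)) x.2) (by
    have := f.scott; fun_prop)

/-- Sending the value `m u` on the used channel, `⊥` if there is no value. -/
noncomputable def impL (m : U →ˢ V) (f : U →ˢ ((A × D) × C →ˢ (A' × D') × C')) :
    U →ˢ ((A × D) × C →ˢ (WithBot (V × A') × D') × C') :=
  ScottMap.lam₂ (fun u x =>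
    let y := f u x
    strictIn (m u) ((((m u, y.1.1) : WithBot (V × A')), y.1.2), y.2)) (by
      have := m.scott; have := f.scott; fun_prop)

/-- Conversion along `i` and `o` of the input and the output on the provided channel. -/
noncomputable def convR (i : B →! C) (o : C' →! B') (f : U →ˢ (D × C →ˢ D' × C')) :
    U →ˢ (D × B →ˢ D' × B') :=
  ScottMap.lam₂ (fun u x => let y := f u (x.1, i x.2); (y.1, o y.2)) (by
    have := f.scott; have := i.scott; have := o.scott; fun_prop)

/-- Conversion along `i` and `o` of the input and the output on the used channel. -/
noncomputable def convL (i : B →! A) (o : A' →! B') (f : U →ˢ ((A × D) × C →ˢ (A' × D') × C')) :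
    U →ˢ ((B × D) × C →ˢ (B' × D') × C') :=
  ScottMap.lam₂ (fun u x =>
    let y := f u ((i x.1.1, x.1.2), x.2)
    ((o y.1.1, y.1.2), y.2)) (by
      have := f.scott; have := i.scott; have := o.scott; fun_prop)

/-- Conversion along `i` and `o` of the inputs and the outputs on all used channels. -/
noncomputable def convCtx (i : X →ˢ D) (o : D' →ˢ Y) (f : U →ˢ (D × C →ˢ D' × C')) :
    U →ˢ (X × C →ˢ Y × C') :=
  ScottMap.lam₂ (fun u x => let y := f u (i x.1, x.2); (o y.1, y.2)) (by
    have := f.scott; have := i.scott; have := o.scott; fun_prop)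

end Sem

/-! ### Denotations of terms and processes -/

/-- The domain of environments for a functional context. -/
noncomputable def ctxDen : List FTy → Dom
  | [] => Dom.one
  | τ :: Ψ => ⟨τ.den × ctxDen Ψ⟩

/-- Functional variables denote projections. -/
noncomputable def Var.den : ∀ {Ψ : List FTy} {τ : FTy}, Var Ψ τ → (ctxDen Ψ →ˢ τ.den)
  | _ :: _, _, .zero => ⟨fun u => u.1, ScottContinuous.fst⟩
  | _ :: _, _, .succ x => ⟨fun u => x.den u.2, scott_comp x.den.scott ScottContinuous.snd⟩

/-- `(δ₁, δ₂)` from `δ₁, δ₂`. -/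
noncomputable def LCtx.split : ∀ (Δ₁ Δ₂ : LCtx) (q : Pol),
    ((Δ₁.append Δ₂).den q →ˢ Δ₁.den q × Δ₂.den q)
  | .nil, _, _ => ⟨fun x => (PUnit.unit, x), ScottContinuous.prodMk (.const _) .id⟩
  | .cons _ Δ₁, Δ₂, q =>
    have h := (Δ₁.split Δ₂ q).scott
    ⟨fun x => ((x.1, (Δ₁.split Δ₂ q x.2).1), (Δ₁.split Δ₂ q x.2).2),
      .prodMk (.prodMk .fst (scott_comp .fst (scott_comp h .snd)))
        (scott_comp .snd (scott_comp h .snd))⟩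

/-- The inverse of `LCtx.split`. -/
noncomputable def LCtx.join : ∀ (Δ₁ Δ₂ : LCtx) (q : Pol),
    (Δ₁.den q × Δ₂.den q →ˢ (Δ₁.append Δ₂).den q)
  | .nil, _, _ => ⟨fun x => x.2, ScottContinuous.snd⟩
  | .cons _ Δ₁, Δ₂, q =>
    ⟨fun x => (x.1.1, Δ₁.join Δ₂ q (x.1.2, x.2)),
      .prodMk (scott_comp .fst .fst)
        (scott_comp (Δ₁.join Δ₂ q).scott (.prodMk (scott_comp .snd .fst) .snd))⟩

/-- The action of a reordering. -/
noncomputable def LCtx.Perm.map : ∀ {Δ Δ' : LCtx}, LCtx.Perm Δ Δ' → ∀ q : Pol,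
    (Δ.den q →ˢ Δ'.den q)
  | _, _, .nil, _ => ⟨fun x => x, ScottContinuous.id⟩
  | _, _, .cons _ π, q =>
    ⟨fun x => (x.1, π.map q x.2), .prodMk .fst (scott_comp (π.map q).scott .snd)⟩
  | _, _, .swap _ _, _ =>
    ⟨fun x => (x.2.1, x.1, x.2.2),
      .prodMk (scott_comp .fst .snd) (.prodMk .fst (scott_comp .snd .snd))⟩
  | _, _, .trans π π', q => ⟨fun x => π'.map q (π.map q x), scott_comp (π'.map q).scott (π.map q).scott⟩

/-- The inverse reordering. -/
def LCtx.Perm.symm : ∀ {Δ Δ' : LCtx}, LCtx.Perm Δ Δ' → LCtx.Perm Δ' Δ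
  | _, _, .nil => .nil
  | _, _, .cons A π => .cons A π.symm
  | _, _, .swap A B => .swap B A
  | _, _, .trans π π' => .trans π'.symm π.symm

mutual

/-- The denotation of a functional term. -/
noncomputable def Tm.den {Ψ : List FTy} {τ : FTy} : Tm Ψ τ → (ctxDen Ψ →ˢ τ.den)
  | .quote P => ⟨fun u => Sem.up (P.den u), scott_comp Sem.up.scott P.den.scott⟩
  | .var x => x.den
  | .fix M => Sem.fix M.den
  | .lam M => Sem.lam M.den
  | .app M N => Sem.app M.den N.den

/-- The denotation of a process: a continuous map from environments to continuous maps from the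
inputs to the outputs on all of its channels. -/
noncomputable def Proc.den {Ψ : List FTy} {Δ : LCtx} {p : Pol} {C : STy [] p} :
    Proc Ψ Δ C → (ctxDen Ψ →ˢ (Δ.den .pos × C.dom .neg →ˢ Δ.den .neg × C.dom .pos))
  | .exch π P => Sem.convCtx (π.symm.map .pos) (π.map .neg) P.den
  | .fwd _ => Sem.fwd
  | .cut (Δ₁ := Δ₁) (Δ₂ := Δ₂) P Q =>
    Sem.convCtx (Δ₁.split Δ₂ .pos) (Δ₁.join Δ₂ .neg) (Sem.cut P.den Q.den)
  | .close => Sem.close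
  | .wait P => Sem.wait P.den
  | .downR P => Sem.upOutR P.den
  | .downL P => Sem.downInL P.den
  | .upR P => Sem.downInR P.den
  | .upL P => Sem.upOutL P.den
  | .plusR k P => Sem.plusR k P.den
  | .plusL P => Sem.plusL fun l => (P l).den
  | .ampR P => Sem.ampR fun l => (P l).den
  | .ampL k P => Sem.ampL k P.den
  | .tensorR P => Sem.tensorR P.den
  | .tensorL P => Sem.tensorL P.den
  | .lollyR P => Sem.lollyR P.den
  | .lollyL P => Sem.lollyL P.den
  | .andR M P => Sem.andR M.den P.den
  | .andL P => Sem.andL P.den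
  | .impR P => Sem.impR P.den
  | .impL M P => Sem.impL M.den P.den
  | .muR (A := A) P => Sem.convR (A.unfold .neg) (A.fold .pos) P.den
  | .muL (A := A) P => Sem.convL (A.unfold .pos) (A.fold .neg) P.den
  | .unquote M => ⟨fun u => Sem.down (M.den u), scott_comp Sem.down.scott M.den.scott⟩

end

/-- Process equivalence: equality of denotations. -/
def Proc.Equiv {Ψ : List FTy} {Δ : LCtx} {p : Pol} {C : STy [] p} (P Q : Proc Ψ Δ C) : Prop :=
  P.den = Q.den

end SILL

namespace SILL

namespace ScottMap

variable {α β γ : Type} [CompletePartialOrder α] [CompletePartialOrder β] [CompletePartialOrder γ]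

/-- Composition of Scott-continuous maps. -/
def comp (g : β →ˢ γ) (f : α →ˢ β) : α →ˢ γ := ⟨fun x => g (f x), scott_comp g.scott f.scott⟩

/-- The map `(v, u) ↦ (v, f u)`. -/
def underBinder (f : α →ˢ β) : γ × α →ˢ γ × β :=
  ⟨fun p => (p.1, f p.2), .prodMk .fst (scott_comp f.scott .snd)⟩

theorem map_lfp (f : α →ˢ α) : f (lfp f) = lfp f := by
  have h := isLUB_iterate f
  have hm : Monotone fun n => f^[n] ⊥ :=
    Monotone.monotone_iterate_of_le_map f.scott.monotone bot_le
  refine (isLUB_map_range hm f.scott h).unique ⟨?_, fun b hb => h.2 ?_⟩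
  · rintro _ ⟨n, rfl⟩
    exact h.1 ⟨n + 1, Function.iterate_succ_apply' f n ⊥⟩
  · rintro _ ⟨n, rfl⟩
    refine (hm n.le_succ).trans ?_
    change f^[n + 1] ⊥ ≤ b
    rw [Function.iterate_succ_apply']
    exact hb ⟨n, rfl⟩

theorem lfp_le (f : α →ˢ α) {x : α} (hx : f x = x) : lfp f ≤ x := by
  refine (isLUB_iterate f).2 ?_
  rintro _ ⟨n, rfl⟩
  induction n with
  | zero => exact bot_le
  | succ n ih =>
    change f^[n + 1] ⊥ ≤ x
    rw [Function.iterate_succ_apply', ← hx]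
    exact f.scott.monotone ih

/-- A monotone map intertwining `f` and `g` carries the least fixed point of `f` to that of `g`,
provided that the latter is the image of some fixed point of `f`. -/
theorem lfp_eq_of_semiconj (f : α →ˢ α) (g : β →ˢ β) (e : α → β) (he : Monotone e)
    (h : ∀ x, g (e x) = e (f x)) (hfix : ∃ x, e x = lfp g ∧ f x = x) :
    lfp g = e (lfp f) := by
  refine le_antisymm (lfp_le g ((h _).trans (congrArg e (map_lfp f)))) ?_
  obtain ⟨x, hx, hfx⟩ := hfix
  exact (he (lfp_le f hfx)).trans hx.le

end ScottMap

namespace Sem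

variable {U V X Y A A' C C' D D' : Type} [CompletePartialOrder U] [CompletePartialOrder V]
  [CompletePartialOrder X] [CompletePartialOrder Y] [CompletePartialOrder A]
  [CompletePartialOrder A'] [CompletePartialOrder C] [CompletePartialOrder C']
  [CompletePartialOrder D] [CompletePartialOrder D']

/-- The map whose least fixed point is the communication on the private channel of a cut. -/
noncomputable def cutStep (f : X × A →ˢ Y × A') (g : (A' × D) × C →ˢ (A × D') × C')
    (w : (X × D) × C) : A × A' →ˢ A × A' :=
  ⟨fun a => ((g ((a.2, w.1.2), w.2)).1.1, (f (w.1.1, a.1)).2), by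
    have := f.scott; have := g.scott; fun_prop⟩

theorem cut_apply (f : U →ˢ (X × A →ˢ Y × A')) (g : U →ˢ ((A' × D) × C →ˢ (A × D') × C'))
    (u : U) (w : (X × D) × C) :
    cut f g u w =
      let a := ScottMap.lfp (cutStep (f u) (g u) w)
      (((f u (w.1.1, a.1)).1, (g u ((a.2, w.1.2), w.2)).1.2), (g u ((a.2, w.1.2), w.2)).2) :=
  rfl

/-- Sending a value that is never `⊥` to its receiver over a cut amounts to substituting it. -/
theorem cut_andR_andL (m : U →ˢ V) (hm : ∀ u, m u ≠ ⊥) (f : U →ˢ (X × A →ˢ Y × A'))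
    (g : V × U →ˢ ((A' × D) × C →ˢ (A × D') × C')) (s : U →ˢ V × U)
    (hs : ∀ u, s u = (m u, u)) :
    cut (andR m f) (andL g) = cut f (g.comp s) := by
  ext1 u
  ext1 w
  have hR : ∀ x, andR m f u x =
      ((f u x).1, ((m u, (f u x).2) : WithBot (V × A'))) := fun x => if_neg (hm u)
  have hL : ∀ (a : A') d c, andL g u ((((m u, a) : V × A'), d), c) = g.comp s u ((a, d), c) := by
    intro a d c
    change g (m u, u) _ = g (s u) _
    rw [hs]
  have key := ScottMap.lfp_eq_of_semiconj (cutStep (f u) (g.comp s u) w)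
    (cutStep (andR m f u) (andL g u) w)
    (fun a => (a.1, ((m u, a.2) : WithBot (V × A'))))
    (fun a b h => ⟨h.1, WithBot.coe_le_coe.2 ⟨le_rfl, h.2⟩⟩)
    (fun x => Prod.ext (congrArg (fun z => z.1.1) (hL _ _ _))
      (congrArg (fun z => z.2) (hR (w.1.1, x.1)))) (by
      have hfix := ScottMap.map_lfp (cutStep (andR m f u) (andL g u) w)
      generalize ScottMap.lfp (cutStep (andR m f u) (andL g u) w) = y at hfix
      obtain ⟨b, c⟩ := y
      have h1 : (andL g u ((c, w.1.2), w.2)).1.1 = b := congrArg Prod.fst hfix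
      have h2 : (andR m f u (w.1.1, b)).2 = c := congrArg Prod.snd hfix
      rw [hR] at h2
      subst h2
      rw [hL] at h1
      exact ⟨(b, (f u (w.1.1, b)).2), rfl, Prod.ext h1 rfl⟩)
  rw [cut_apply, cut_apply, key]
  simp only [hR, hL]

end Sem

/-- The semantic environment without its most recent entry. -/
noncomputable def ctxTail {Ψ : List FTy} (σ : FTy) : ctxDen (σ :: Ψ) →ˢ ctxDen Ψ :=
  ⟨fun u => u.2, by exact ScottContinuous.snd⟩

/-- The action of a map of environments under a binder. -/
noncomputable def ctxLift {Ψ Φ : List FTy} (S : ctxDen Φ →ˢ ctxDen Ψ) (σ : FTy) :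
    ctxDen (σ :: Φ) →ˢ ctxDen (σ :: Ψ) := S.underBinder (γ := σ.den)

theorem Ren.den_lift {Ψ Φ : List FTy} (ξ : Ren Ψ Φ) (S : ctxDen Φ →ˢ ctxDen Ψ)
    (h : ∀ τ x, (ξ τ x).den = x.den.comp S) {σ : FTy} (τ : FTy) (x : Var (σ :: Ψ) τ) :
    (ξ.lift _ x).den = x.den.comp (ctxLift S σ) :=
  match x with
  | .zero => rfl
  | .succ x => congrArg (fun f => f.comp (ctxTail σ)) (h τ x)

mutual

theorem Tm.den_ren {Ψ Φ : List FTy} {τ : FTy} (M : Tm Ψ τ) (ξ : Ren Ψ Φ)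
    (S : ctxDen Φ →ˢ ctxDen Ψ) (h : ∀ τ x, (ξ τ x).den = x.den.comp S) :
    (M.ren ξ).den = M.den.comp S :=
  match M with
  | .quote P => ScottMap.ext fun u => congrArg Sem.up (DFunLike.congr_fun (P.den_ren ξ S h) u)
  | .var x => h _ x
  | .fix M => by
    rw [Tm.ren, Tm.den, Tm.den, M.den_ren ξ.lift (ctxLift S _) (Ren.den_lift ξ S h)]
    rfl
  | .lam M => by
    rw [Tm.ren, Tm.den, Tm.den, M.den_ren ξ.lift (ctxLift S _) (Ren.den_lift ξ S h)]
    rfl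
  | .app M N => by rw [Tm.ren, Tm.den, Tm.den, M.den_ren ξ S h, N.den_ren ξ S h]; rfl

theorem Proc.den_ren {Ψ Φ : List FTy} {Δ : LCtx} {p : Pol} {C : STy [] p}
    (P : Proc Ψ Δ C) (ξ : Ren Ψ Φ)
    (S : ctxDen Φ →ˢ ctxDen Ψ) (h : ∀ τ x, (ξ τ x).den = x.den.comp S) :
    (P.ren ξ).den = P.den.comp S :=
  match P with
  | .exch _ P => by rw [Proc.ren, Proc.den, Proc.den, P.den_ren ξ S h]; rfl
  | .fwd _ => rfl
  | .cut P Q => by rw [Proc.ren, Proc.den, Proc.den, P.den_ren ξ S h, Q.den_ren ξ S h]; rfl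
  | .close => rfl
  | .wait P => by rw [Proc.ren, Proc.den, Proc.den, P.den_ren ξ S h]; rfl
  | .downR P => by rw [Proc.ren, Proc.den, Proc.den, P.den_ren ξ S h]; rfl
  | .downL P => by rw [Proc.ren, Proc.den, Proc.den, P.den_ren ξ S h]; rfl
  | .upR P => by rw [Proc.ren, Proc.den, Proc.den, P.den_ren ξ S h]; rfl
  | .upL P => by rw [Proc.ren, Proc.den, Proc.den, P.den_ren ξ S h]; rfl
  | .plusR _ P => by rw [Proc.ren, Proc.den, Proc.den, P.den_ren ξ S h]; rfl
  | .plusL P => by rw [Proc.ren, Proc.den, Proc.den, funext fun l => (P l).den_ren ξ S h]; rfl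
  | .ampR P => by rw [Proc.ren, Proc.den, Proc.den, funext fun l => (P l).den_ren ξ S h]; rfl
  | .ampL _ P => by rw [Proc.ren, Proc.den, Proc.den, P.den_ren ξ S h]; rfl
  | .tensorR P => by rw [Proc.ren, Proc.den, Proc.den, P.den_ren ξ S h]; rfl
  | .tensorL P => by rw [Proc.ren, Proc.den, Proc.den, P.den_ren ξ S h]; rfl
  | .lollyR P => by rw [Proc.ren, Proc.den, Proc.den, P.den_ren ξ S h]; rfl
  | .lollyL P => by rw [Proc.ren, Proc.den, Proc.den, P.den_ren ξ S h]; rfl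
  | .andR M P => by rw [Proc.ren, Proc.den, Proc.den, M.den_ren ξ S h, P.den_ren ξ S h]; rfl
  | .andL P => by
    rw [Proc.ren, Proc.den, Proc.den, P.den_ren ξ.lift (ctxLift S _) (Ren.den_lift ξ S h)]
    rfl
  | .impR P => by
    rw [Proc.ren, Proc.den, Proc.den, P.den_ren ξ.lift (ctxLift S _) (Ren.den_lift ξ S h)]
    rfl
  | .impL M P => by rw [Proc.ren, Proc.den, Proc.den, M.den_ren ξ S h, P.den_ren ξ S h]; rfl
  | .muR P => by rw [Proc.ren, Proc.den, Proc.den, P.den_ren ξ S h]; rfl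
  | .muL P => by rw [Proc.ren, Proc.den, Proc.den, P.den_ren ξ S h]; rfl
  | .unquote M => ScottMap.ext fun u => congrArg Sem.down (DFunLike.congr_fun (M.den_ren ξ S h) u)

end

theorem Sub.den_lift {Ψ Φ : List FTy} (s : Sub Ψ Φ) (S : ctxDen Φ →ˢ ctxDen Ψ)
    (h : ∀ τ x, (s τ x).den = x.den.comp S) {σ : FTy} (τ : FTy) (x : Var (σ :: Ψ) τ) :
    (s.lift _ x).den = x.den.comp (ctxLift S σ) :=
  match x with
  | .zero => rfl
  | .succ x => ((s τ x).den_ren (fun _ => .succ) (ctxTail σ) fun _ _ => rfl).trans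
      (congrArg (fun f => f.comp (ctxTail σ)) (h τ x))

mutual

theorem Tm.den_subst {Ψ Φ : List FTy} {τ : FTy} (M : Tm Ψ τ) (s : Sub Ψ Φ)
    (S : ctxDen Φ →ˢ ctxDen Ψ) (h : ∀ τ x, (s τ x).den = x.den.comp S) :
    (M.subst s).den = M.den.comp S :=
  match M with
  | .quote P => ScottMap.ext fun u => congrArg Sem.up (DFunLike.congr_fun (P.den_subst s S h) u)
  | .var x => h _ x
  | .fix M => by
    rw [Tm.subst, Tm.den, Tm.den, M.den_subst s.lift (ctxLift S _) (Sub.den_lift s S h)]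
    rfl
  | .lam M => by
    rw [Tm.subst, Tm.den, Tm.den, M.den_subst s.lift (ctxLift S _) (Sub.den_lift s S h)]
    rfl
  | .app M N => by rw [Tm.subst, Tm.den, Tm.den, M.den_subst s S h, N.den_subst s S h]; rfl

theorem Proc.den_subst {Ψ Φ : List FTy} {Δ : LCtx} {p : Pol} {C : STy [] p}
    (P : Proc Ψ Δ C) (s : Sub Ψ Φ)
    (S : ctxDen Φ →ˢ ctxDen Ψ) (h : ∀ τ x, (s τ x).den = x.den.comp S) :
    (P.subst s).den = P.den.comp S :=
  match P with
  | .exch _ P => by rw [Proc.subst, Proc.den, Proc.den, P.den_subst s S h]; rfl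
  | .fwd _ => rfl
  | .cut P Q => by rw [Proc.subst, Proc.den, Proc.den, P.den_subst s S h, Q.den_subst s S h]; rfl
  | .close => rfl
  | .wait P => by rw [Proc.subst, Proc.den, Proc.den, P.den_subst s S h]; rfl
  | .downR P => by rw [Proc.subst, Proc.den, Proc.den, P.den_subst s S h]; rfl
  | .downL P => by rw [Proc.subst, Proc.den, Proc.den, P.den_subst s S h]; rfl
  | .upR P => by rw [Proc.subst, Proc.den, Proc.den, P.den_subst s S h]; rfl
  | .upL P => by rw [Proc.subst, Proc.den, Proc.den, P.den_subst s S h]; rfl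
  | .plusR _ P => by rw [Proc.subst, Proc.den, Proc.den, P.den_subst s S h]; rfl
  | .plusL P => by rw [Proc.subst, Proc.den, Proc.den, funext fun l => (P l).den_subst s S h]; rfl
  | .ampR P => by rw [Proc.subst, Proc.den, Proc.den, funext fun l => (P l).den_subst s S h]; rfl
  | .ampL _ P => by rw [Proc.subst, Proc.den, Proc.den, P.den_subst s S h]; rfl
  | .tensorR P => by rw [Proc.subst, Proc.den, Proc.den, P.den_subst s S h]; rfl
  | .tensorL P => by rw [Proc.subst, Proc.den, Proc.den, P.den_subst s S h]; rfl
  | .lollyR P => by rw [Proc.subst, Proc.den, Proc.den, P.den_subst s S h]; rfl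
  | .lollyL P => by rw [Proc.subst, Proc.den, Proc.den, P.den_subst s S h]; rfl
  | .andR M P => by rw [Proc.subst, Proc.den, Proc.den, M.den_subst s S h, P.den_subst s S h]; rfl
  | .andL P => by
    rw [Proc.subst, Proc.den, Proc.den, P.den_subst s.lift (ctxLift S _) (Sub.den_lift s S h)]
    rfl
  | .impR P => by
    rw [Proc.subst, Proc.den, Proc.den, P.den_subst s.lift (ctxLift S _) (Sub.den_lift s S h)]
    rfl
  | .impL M P => by rw [Proc.subst, Proc.den, Proc.den, M.den_subst s S h, P.den_subst s S h]; rfl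
  | .muR P => by rw [Proc.subst, Proc.den, Proc.den, P.den_subst s S h]; rfl
  | .muL P => by rw [Proc.subst, Proc.den, Proc.den, P.den_subst s S h]; rfl
  | .unquote M => ScottMap.ext fun u => congrArg Sem.down (DFunLike.congr_fun (M.den_subst s S h) u)

end

theorem Proc.den_inst {Ψ : List FTy} {σ : FTy} {Δ : LCtx} {p : Pol} {C : STy [] p}
    (Q : Proc (σ :: Ψ) Δ C) (M : Tm Ψ σ) :
    (Q.inst M).den = Q.den.comp
      (⟨fun u => (M.den u, u), .prodMk M.den.scott .id⟩ : ctxDen Ψ →ˢ σ.den × ctxDen Ψ) :=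
  Q.den_subst (Sub.single M) _ fun _ x => match x with
    | .zero => rfl
    | .succ _ => rfl

end SILL

theorem mainTheorem3 {Ψ : List SILL.FTy} {Δ₁ Δ₂ : SILL.LCtx} {τ : SILL.FTy} {p : SILL.Pol}
    {A : SILL.STy [] .pos} {C : SILL.STy [] p}
    (P : SILL.Proc Ψ Δ₁ A) (Q : SILL.Proc (τ :: Ψ) (.cons A Δ₂) C) (M : SILL.Tm Ψ τ)
    (hM : ∀ u : SILL.ctxDen Ψ, M.den u ≠ ⊥) :
    SILL.Proc.Equiv (.cut P (Q.inst M)) (.cut (.andR M P) (.andL Q)) := by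
  have h : SILL.Sem.cut P.den (Q.inst M).den =
      SILL.Sem.cut (SILL.Sem.andR M.den P.den) (SILL.Sem.andL Q.den) := by
    rw [Q.den_inst M]
    exact (SILL.Sem.cut_andR_andL M.den hM P.den Q.den _ fun _ => rfl).symm
  exact congrArg (SILL.Sem.convCtx (Δ₁.split Δ₂ .pos) (Δ₁.join Δ₂ .neg)) h
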